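/- Let $n \ge 0$ and let $\lambda,\mu$ be partitions with at most $n$ parts. For a partition $\nu$ with at most $n$ parts let $\mathscr{B}(\nu)$ be the $\mathfrak{sl}_n$-crystal of semistandard Young tableaux of shape $\nu$ with entries in $\{1,\dots,n\}$, with the usual crystal operators $e_i,f_i:\mathscr{B}(\nu)\to\mathscr{B}(\nu)\sqcup\{0\}$, $1\le i<n$: in the row reading word of $T$ (rows from bottom to top, each read from left to right), bracket letters $i+1$ with letters $i$ to their right; $f_i$ changes the rightmost unbracketed $i$ to $i+1$, $e_i$ changes the leftmost unbracketed $i+1$ to $i$, and the result is $0$ if there is no such letter. For $T\in\mathscr{B}(\nu)$ let $\mathsf{E}(T)$ (resp. $\mathsf{F}(T)$) be the set of nonzero elements obtained from $T$ by applying finite, possibly empty, sequences of operators $e_i$ (resp. $f_i$). A highest (resp. lowest) weight vector of $\mathscr{B}(\nu)$ is an element $T$ with $\mathsf{E}(T)=\{T\}$ (resp. $\mathsf{F}(T)=\{T\}$). For tableaux $T'\in\mathscr{B}(\lambda)$, $T\in\mathscr{B}(\mu)$, the star product $T'\star T\in\mathscr{B}(\lambda+\mu)$ is obtained by concatenating the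 rows and sorting each row; put $\Phi_T:\mathscr{B}(\lambda)\to\mathscr{B}(\lambda+\mu)$, $\Phi_T(T')=T'\star T$. A map $\Phi$ of crystals is an embedding if it is injective, $e_i(x)\ne0$ implies $\Phi(e_i(x))=e_i(\Phi(x))\neq 0$, and $f_i(x)\ne 0$ implies $\Phi(f_i(x))=f_i(\Phi(x))\ne0$. Each $\mathscr{B}(\nu)$ has a unique highest weight vector $A_\nu$, the tableau whose $i$-th row has all entries equal to $i$, and a unique lowest weight vector $Z_\nu$, the tableau in which every column of height $h$ has the entries $n-h+1,\dots,n$. If $T$ is the highest or the lowest weight vector of $\mathscr{B}(\mu)$, then $\Phi_T$ is a crystal embedding. Moreover $$\Phi_{A_\mu}(\mathscr{B}(\lambda))=\mathsf{E}(Z_\lambda\star A_\mu),\qquad \Phi_{Z_\mu}(\mathscr{B}(\lambda))=\mathsf{F}(A_\lambda\star Z_\mu),$$ $\Phi_{A_\mu}$ and $\Phi_{Z_\mu}$ are isomorphisms of coloured directed graphs from $\mathscr{B}(\lambda)$ onto the subgraphs of $\mathscr{B}(\lambda+\mu)$ induced on these images, and these two induced subgraphs are isomorphic to each other. -/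

import Mathlib

/-- The sum `κ + ν` of two partitions: row `i` has `κ_i + ν_i` cells. -/
def shapeAdd (κ ν : YoungDiagram) : YoungDiagram where
  cells := (Finset.range (κ.colLen 0 + ν.colLen 0) ×ˢ
    Finset.range (κ.rowLen 0 + ν.rowLen 0)).filter
      fun c => c.2 < κ.rowLen c.1 + ν.rowLen c.1
  isLowerSet := by
    rintro ⟨i, j⟩ ⟨i', j'⟩ ⟨h1, h2⟩ h
    simp only [Finset.coe_filter, Finset.mem_product, Finset.mem_range, Set.mem_ofPred_eq] at *
    have a := κ.rowLen_anti i' i h1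
    have b := ν.rowLen_anti i' i h1
    omega

theorem mem_shapeAdd {κ ν : YoungDiagram} {i j : ℕ} :
    (i, j) ∈ shapeAdd κ ν ↔ j < κ.rowLen i + ν.rowLen i := by
  have key : (i, j) ∈ shapeAdd κ ν ↔ (i, j) ∈ (shapeAdd κ ν).cells := Iff.rfl
  rw [key]
  simp only [shapeAdd, Finset.mem_filter, Finset.mem_product, Finset.mem_range,
    and_iff_right_iff_imp]
  intro h
  have a := κ.rowLen_anti 0 i (Nat.zero_le _)
  have b := ν.rowLen_anti 0 i (Nat.zero_le _)
  refine ⟨?_, by omega⟩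
  rcases Nat.eq_zero_or_pos (κ.rowLen i) with h0 | h0
  · have : (i, 0) ∈ ν := YoungDiagram.mem_iff_lt_rowLen.2 (by omega)
    have := YoungDiagram.mem_iff_lt_colLen.1 this
    omega
  · have : (i, 0) ∈ κ := YoungDiagram.mem_iff_lt_rowLen.2 h0
    have := YoungDiagram.mem_iff_lt_colLen.1 this
    omega

/-- `SSYT_n(ν)`, the vertex set of the crystal `B(ν)`: semistandard tableaux of shape `ν` with
entries in `{1, …, n}`. Rows and columns are indexed from `0`. -/
def Tab (n : ℕ) (ν : YoungDiagram) : Type :=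
  {T : SemistandardYoungTableau ν // ∀ i j, (i, j) ∈ ν → 1 ≤ T i j ∧ T i j ≤ n}

namespace Tab

variable {n : ℕ} {κ ν : YoungDiagram}

/-- The `i`-th row of a tableau, read from left to right. -/
def row (T : Tab n ν) (i : ℕ) : List ℕ :=
  (List.range (ν.rowLen i)).map fun j => T.1 i j

/-- The row reading word: rows from bottom to top, each read from left to right. -/
def reading (T : Tab n ν) : List ℕ :=
  (List.range (ν.colLen 0)).reverse.flatMap fun i => T.row i

/-- The `i`-th row of the star product: concatenate the rows and sort. -/
def starRow (T : Tab n κ) (T' : Tab n ν) (i : ℕ) : List ℕ :=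
  (T.row i ++ T'.row i).insertionSort (· ≤ ·)

theorem lt_countP_iff (p : ℕ → Bool) (hp : ∀ a b, a ≤ b → p b = true → p a = true)
    (s : List ℕ) (hs : s.Pairwise (· ≤ ·)) (j : ℕ) (hj : j < s.length) :
    j < s.countP p ↔ p (s.getD j 0) = true := by
  induction s generalizing j with
  | nil => simp at hj
  | cons a s ih =>
    rw [List.pairwise_cons] at hs
    cases j with
    | zero =>
      rw [List.countP_pos_iff]
      simp only [List.mem_cons, exists_eq_or_imp, List.getD_cons_zero, or_iff_left_iff_imp]
      rintro ⟨b, hb, hpb⟩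
      exact hp a b (hs.1 b hb) hpb
    | succ j =>
      have hj' : j < s.length := by simpa using hj
      have := ih hs.2 j hj'
      rw [List.getD_cons_succ, ← this, List.countP_cons]
      by_cases ha : p a = true
      · simp [ha]
      · have h0 : s.countP p = 0 := by
          rw [List.countP_eq_zero]
          exact fun b hb hpb => ha (hp a b (hs.1 b hb) hpb)
        simp [ha, h0]

theorem countP_row_le (T : Tab n ν) {i i' : ℕ} (hi : i < i') (x : ℕ) :
    (T.row i').countP (fun y => decide (y ≤ x)) ≤ (T.row i).countP (fun y => decide (y < x)) := by
  unfold row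
  rw [List.countP_map, List.countP_map]
  have hlen := ν.rowLen_anti i i' hi.le
  refine le_trans (List.countP_mono_left (q := fun j => decide (T.1 i j < x)) ?_)
    ((List.range_sublist.2 hlen).countP_le)
  intro j hj h
  simp only [Function.comp_apply, decide_eq_true_eq] at *
  exact lt_of_lt_of_le
    (T.1.col_strict hi (YoungDiagram.mem_iff_lt_rowLen.2 (List.mem_range.1 hj))) h

theorem length_starRow (T : Tab n κ) (T' : Tab n ν) (i : ℕ) :
    (starRow T T' i).length = κ.rowLen i + ν.rowLen i := by
  simp [starRow, row]

theorem pairwise_starRow (T : Tab n κ) (T' : Tab n ν) (i : ℕ) :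
    (starRow T T' i).Pairwise (· ≤ ·) :=
  List.pairwise_insertionSort _ _

/-- The star product `T ⋆ T'`, of shape `κ + ν`. -/
def star (T : Tab n κ) (T' : Tab n ν) : Tab n (shapeAdd κ ν) :=
  ⟨{ entry := fun i j => (starRow T T' i).getD j 0
     row_weak' := by
       intro i j1 j2 hj hc
       have h2 : j2 < (starRow T T' i).length := by
         rw [length_starRow]; exact mem_shapeAdd.1 hc
       have h1 : j1 < (starRow T T' i).length := hj.trans h2
       rw [List.getD_eq_getElem _ _ h1, List.getD_eq_getElem _ _ h2]
       exact List.pairwise_iff_getElem.1 (pairwise_starRow T T' i) j1 j2 h1 h2 hj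
     col_strict' := by
       intro i1 i2 j hi hc
       have h2 : j < (starRow T T' i2).length := by
         rw [length_starRow]; exact mem_shapeAdd.1 hc
       have h1 : j < (starRow T T' i1).length := by
         rw [length_starRow] at h2 ⊢
         have a := κ.rowLen_anti i1 i2 hi.le
         have b := ν.rowLen_anti i1 i2 hi.le
         omega
       generalize hx : (starRow T T' i2).getD j 0 = x
       have e2 := (lt_countP_iff (fun y => decide (y ≤ x))
         (fun a b hab hb => by simp only [decide_eq_true_eq] at *; omega) _
         (pairwise_starRow T T' i2) j h2).2 (by simp only [decide_eq_true_eq]; exact hx.le)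
       have e1 := (lt_countP_iff (fun y => decide (y < x))
         (fun a b hab hb => by simp only [decide_eq_true_eq] at *; omega) _
         (pairwise_starRow T T' i1) j h1).1 (by
           refine lt_of_lt_of_le e2 ?_
           unfold starRow
           rw [(List.perm_insertionSort _ _).countP_eq, (List.perm_insertionSort _ _).countP_eq,
             List.countP_append, List.countP_append]
           exact Nat.add_le_add (countP_row_le T hi x) (countP_row_le T' hi x))
       simpa using e1
     zeros' := by
       intro i j hc
       rw [List.getD_eq_default]
       rw [length_starRow]
       exact not_lt.1 fun h => hc (mem_shapeAdd.2 h) },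
   by
     intro i j hc
     have h : j < (starRow T T' i).length := by
       rw [length_starRow]; exact mem_shapeAdd.1 hc
     change 1 ≤ (starRow T T' i).getD j 0 ∧ (starRow T T' i).getD j 0 ≤ n
     rw [List.getD_eq_getElem _ _ h]
     have hm := List.getElem_mem h
     generalize (starRow T T' i)[j] = x at hm
     simp only [starRow, List.mem_insertionSort, List.mem_append, row, List.mem_map,
       List.mem_range] at hm
     rcases hm with ⟨k, hk, rfl⟩ | ⟨k, hk, rfl⟩
     · exact T.2 i k (YoungDiagram.mem_iff_lt_rowLen.2 hk)
     · exact T'.2 i k (YoungDiagram.mem_iff_lt_rowLen.2 hk)⟩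

/-- The tableau `A_ν`: every entry of the `i`-th row is `i` (with rows counted from `1`). -/
def A (n : ℕ) (ν : YoungDiagram) (h : ν.colLen 0 ≤ n) : Tab n ν :=
  ⟨{ entry := fun i j => if (i, j) ∈ ν then i + 1 else 0
     row_weak' := by
       intro i j1 j2 hj hc
       have := ν.up_left_mem le_rfl hj.le hc
       simp [this, hc]
     col_strict' := by
       intro i1 i2 j hi hc
       have := ν.up_left_mem hi.le le_rfl hc
       simp [this, hc, hi]
     zeros' := by
       intro i j hc
       simp [hc] },
   by
     intro i j hc
     change 1 ≤ (if (i, j) ∈ ν then i + 1 else 0) ∧ (if (i, j) ∈ ν then i + 1 else 0) ≤ n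
     have h1 := YoungDiagram.mem_iff_lt_colLen.1 hc
     have h2 := ν.colLen_anti 0 j (Nat.zero_le _)
     rw [if_pos hc]
     omega⟩

/-- The tableau `Z_ν`: a column of height `h` has the entries `n - h + 1, …, n`. -/
def Z (n : ℕ) (ν : YoungDiagram) (h : ν.colLen 0 ≤ n) : Tab n ν :=
  ⟨{ entry := fun i j => if (i, j) ∈ ν then n - ν.colLen j + (i + 1) else 0
     row_weak' := by
       intro i j1 j2 hj hc
       have := ν.up_left_mem le_rfl hj.le hc
       have h2 := ν.colLen_anti j1 j2 hj.le
       simp only [this, hc, if_true]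
       omega
     col_strict' := by
       intro i1 i2 j hi hc
       have := ν.up_left_mem hi.le le_rfl hc
       simp [this, hc, hi]
     zeros' := by
       intro i j hc
       simp [hc] },
   by
     intro i j hc
     change 1 ≤ (if (i, j) ∈ ν then n - ν.colLen j + (i + 1) else 0) ∧
       (if (i, j) ∈ ν then n - ν.colLen j + (i + 1) else 0) ≤ n
     have h1 := YoungDiagram.mem_iff_lt_colLen.1 hc
     have h2 := ν.colLen_anti 0 j (Nat.zero_le _)
     rw [if_pos hc]
     omega⟩

end Tab

/-!
The crystal structure on words in the letters `1, …, n`. A word `x₁ x₂ ⋯ x_k` stands for the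
element `x₁ ⊗ (x₂ ⊗ (⋯ ⊗ x_k))` of the `k`-th tensor power of the standard crystal
`1 → 2 → ⋯ → n`, with the tensor product rule

* `f_i (x ⊗ y) = x ⊗ f_i y` if `ε_i x < φ_i y`, and `f_i x ⊗ y` otherwise,
* `e_i (x ⊗ y) = x ⊗ e_i y` if `ε_i x ≤ φ_i y`, and `e_i x ⊗ y` otherwise.

Equivalently: bracket every letter `i + 1` with a letter `i` to its right; `f_i` changes the
rightmost unbracketed `i` to `i + 1`, `e_i` the leftmost unbracketed `i + 1` to `i`.
The value `none` stands for `0`.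
-/

/-- `φ_i` of a letter. -/
def letterPhi (i x : ℕ) : ℕ := if x = i then 1 else 0

/-- `ε_i` of a letter. -/
def letterEps (i x : ℕ) : ℕ := if x = i + 1 then 1 else 0

/-- `f_i` on a letter. -/
def letterF (i x : ℕ) : Option ℕ := if x = i then some (i + 1) else none

/-- `e_i` on a letter. -/
def letterE (i x : ℕ) : Option ℕ := if x = i + 1 then some i else none

/-- `φ_i` of a word: `φ_i (x ⊗ y) = φ_i x + max (0, φ_i y - ε_i x)`. The truncated
subtraction of natural numbers is the intended one. -/
def wordPhi (i : ℕ) : List ℕ → ℕ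
  | [] => 0
  | x :: w => letterPhi i x + (wordPhi i w - letterEps i x)

/-- `f_i` on words. -/
def wordF (i : ℕ) : List ℕ → Option (List ℕ)
  | [] => none
  | x :: w =>
    if letterEps i x < wordPhi i w then (wordF i w).map fun w' => x :: w'
    else (letterF i x).map fun x' => x' :: w

/-- `e_i` on words. -/
def wordE (i : ℕ) : List ℕ → Option (List ℕ)
  | [] => none
  | x :: w =>
    if letterEps i x ≤ wordPhi i w then (wordE i w).map fun w' => x :: w'
    else (letterE i x).map fun x' => x' :: w

/-- The index set `{1, …, n - 1}` of the crystal operators. -/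
abbrev CrystalIndex (n : ℕ) : Type := {i : ℕ // 1 ≤ i ∧ i < n}

namespace Tab

variable {n : ℕ} {κ ν : YoungDiagram}

open Classical in
/-- `f_i` on `B(ν)`: the operator induced from words through the row reading word, which is
injective on tableaux of a fixed shape. -/
noncomputable def f (i : CrystalIndex n) (T : Tab n ν) : Option (Tab n ν) :=
  if h : ∃ T' : Tab n ν, wordF i T.reading = some T'.reading then some h.choose else none

open Classical in
/-- `e_i` on `B(ν)`. -/
noncomputable def e (i : CrystalIndex n) (T : Tab n ν) : Option (Tab n ν) :=
  if h : ∃ T' : Tab n ν, wordE i T.reading = some T'.reading then some h.choose else none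

/-- The action on `B(ν) ∪ {0}` of a word in operators `g i`; the rightmost operator acts first. -/
def act (g : CrystalIndex n → Tab n ν → Option (Tab n ν)) :
    List (CrystalIndex n) → Tab n ν → Option (Tab n ν)
  | [], T => some T
  | i :: w, T => (act g w T).bind (g i)

/-- `E(T)`: the nonzero elements obtained from `T` under the free monoid on the `e_i`. -/
def E (T : Tab n ν) : Set (Tab n ν) :=
  {T' | ∃ w : FreeMonoid (CrystalIndex n), act e w.toList T = some T'}

/-- `F(T)`: the nonzero elements obtained from `T` under the free monoid on the `f_i`. -/
def F (T : Tab n ν) : Set (Tab n ν) :=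
  {T' | ∃ w : FreeMonoid (CrystalIndex n), act f w.toList T = some T'}

/-- Highest weight vectors of `B(ν)`. -/
def IsHighestWeight (T : Tab n ν) : Prop := E T = {T}

/-- Lowest weight vectors of `B(ν)`. -/
def IsLowestWeight (T : Tab n ν) : Prop := F T = {T}

/-- Embeddings of crystals. -/
def IsCrystalEmbedding (Φ : Tab n κ → Tab n ν) : Prop :=
  Function.Injective Φ ∧
  (∀ i x, e i x ≠ none → (e i x).map Φ = e i (Φ x) ∧ e i (Φ x) ≠ none) ∧
  (∀ i x, f i x ≠ none → (f i x).map Φ = f i (Φ x) ∧ f i (Φ x) ≠ none)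

/-- A bijection between vertex sets `S ⊆ B(κ)` and `S' ⊆ B(ν)` that is an isomorphism of the
induced coloured directed subgraphs. -/
def IsInducedIso {S : Set (Tab n κ)} {S' : Set (Tab n ν)} (ψ : S ≃ S') : Prop :=
  ∀ (i : CrystalIndex n) (x y : S),
    (f i x.1 = some y.1 ↔ f i (ψ x).1 = some (ψ y).1) ∧
    (e i x.1 = some y.1 ↔ e i (ψ x).1 = some (ψ y).1)

/-- The map `Φ_T : B(κ) → B(κ + ν)`, `T' ↦ T' ⋆ T`. -/
def starMap (κ : YoungDiagram) (T : Tab n ν) : Tab n κ → Tab n (shapeAdd κ ν) :=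
  fun T' => star T' T

end Tab

/-! ### Signatures of sequences of rows -/

/-! Only the numbers of letters i and i + 1 in each row matter to the operators of colour i. A
sorted row has its letters i to the left of its letters i + 1, so no bracketing happens inside a
row; letters i + 1 cancel letters i of the rows above. A recursion over these counts (`sigPhi`,
`sigF`, `sigE`) therefore finds the row on which f_i or e_i acts. The operator then only changes one
letter of that row (`f_eq_some_iff`, `e_eq_some_iff`). Since the star product is the union of
multisets in each row, it commutes with such a change (`Raise.star`). It remains to see that
multiplying by an extremal tableau does not move the selected row.

For A_μ, the added letters i + 1 all lie in one row, directly below the row of the added letters i,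
which are at least as many. No letter i + 1 of T' lies lower, and the extra unbracketed letters i do
no harm to e_i: the row selected by e_i is unchanged (`sigE_star_A`). For Z_μ, the letters i of a
row are matched in number by the letters i + 1 of the next row, so the additions cancel from row to
row and the row selected by f_i is unchanged (`sigF_star_Z`).

Hence Φ_A commutes with every e_i and Φ_Z with every f_i, including the value 0. The other family of
operators follows because e_i and f_i are partial inverses. The image of Φ_A is closed under all
e_i, and every element of B(λ) is reached from Z_λ by operators e_i; this yields the image as a set
E(...), and dually for Φ_Z. Both images are copies of B(λ), hence isomorphic. -/

/-- `φ` of the first `k` rows, where row `r` contains `a r` letters `i` and `b r` letters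
`i + 1`. -/
def sigPhi (a b : ℕ → ℕ) : ℕ → ℕ
  | 0 => 0
  | k + 1 => a k + (sigPhi a b k - b k)

/-- The row on which `f_i` acts. -/
def sigF (a b : ℕ → ℕ) : ℕ → Option ℕ
  | 0 => none
  | k + 1 => if b k < sigPhi a b k then sigF a b k else if 0 < a k then some k else none

/-- The row on which `e_i` acts. -/
def sigE (a b : ℕ → ℕ) : ℕ → Option ℕ
  | 0 => none
  | k + 1 => if b k ≤ sigPhi a b k then sigE a b k else some k

section Signature

variable {a b a' b' : ℕ → ℕ} {k r : ℕ}

theorem sigPhi_congr (h : ∀ s < k, a s = a' s ∧ b s = b' s) : sigPhi a b k = sigPhi a' b' k := by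
  induction k with
  | zero => rfl
  | succ k ih =>
    have := h k (by omega)
    simp only [sigPhi, ih fun s hs => h s (by omega), this]

theorem sigF_lt (h : sigF a b k = some r) : r < k := by
  induction k with
  | zero => simp [sigF] at h
  | succ k ih =>
    simp only [sigF] at h
    split_ifs at h
    · have := ih h; omega
    · simp at h; omega

theorem sigE_lt (h : sigE a b k = some r) : r < k := by
  induction k with
  | zero => simp [sigE] at h
  | succ k ih =>
    simp only [sigE] at h
    split_ifs at h
    · have := ih h; omega
    · simp at h; omega

theorem sigF_eq_none_iff : sigF a b k = none ↔ sigPhi a b k = 0 := by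
  induction k with
  | zero => simp [sigF, sigPhi]
  | succ k ih =>
    simp only [sigF, sigPhi]
    split_ifs with h1 h2
    · rw [ih]; omega
    · simp; omega
    · simp; omega

theorem sigE_eq_none_iff : sigE a b k = none ↔ ∀ s < k, b s ≤ sigPhi a b s := by
  induction k with
  | zero => simp [sigE]
  | succ k ih =>
    simp only [sigE]
    split_ifs with h1
    · rw [ih]
      refine ⟨fun h s hs => ?_, fun h s hs => h s (by omega)⟩
      rcases Nat.lt_succ_iff_lt_or_eq.1 hs with h' | rfl
      · exact h s h'
      · exact h1
    · simp only [false_iff, not_forall]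
      exact ⟨k, by omega, h1⟩

/-- The second inequality is what keeps columns strict after a letter of row r is raised. The rows
above r offer no unbracketed i beyond those cancelled by row r, so the letter surviving row r + 1
must come from the `a r` letters of row r itself. -/
theorem sigF_some (h : sigF a b k = some r) : 0 < a r ∧ (r + 1 < k → b (r + 1) < a r) := by
  induction k with
  | zero => simp [sigF] at h
  | succ k ih =>
    simp only [sigF] at h
    split_ifs at h with h1 h2
    · refine ⟨(ih h).1, fun hr => ?_⟩
      rcases Nat.lt_succ_iff_lt_or_eq.1 hr with h' | rfl
      · exact (ih h).2 h'
      · simp only [sigF] at h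
        simp only [sigPhi] at h1
        split_ifs at h with h3 h4
        · have := sigF_lt h; omega
        · omega
    · simp only [Option.some.injEq] at h
      subst h
      exact ⟨h2, by omega⟩

theorem sigE_some (h : sigE a b k = some r) : sigPhi a b r < b r := by
  induction k with
  | zero => simp [sigE] at h
  | succ k ih =>
    simp only [sigE] at h
    split_ifs at h with h1
    · exact ih h
    · simp only [Option.some.injEq] at h
      subst h
      omega

/-- `f_i` and `e_i` are partial inverses of each other. -/
theorem sigF_iff_sigE (ha : ∀ s ≠ r, a s = a' s) (hb : ∀ s ≠ r, b s = b' s)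
    (har : a r = a' r + 1) (hbr : b' r = b r + 1) :
    sigF a b k = some r ↔ sigE a' b' k = some r := by
  have h0 : ∀ k ≤ r, sigPhi a b k = sigPhi a' b' k := fun k hk =>
    sigPhi_congr fun s hs => ⟨ha s (by omega), hb s (by omega)⟩
  -- Past row r the two values of `sigPhi` differ by exactly one as long as row r stays selected,
  -- which turns the strict test of `sigF` into the weak test of `sigE`.
  have key : ∀ k, (sigF a b k = some r → sigPhi a b k = sigPhi a' b' k + 1 ∧
        sigE a' b' k = some r) ∧
      (sigE a' b' k = some r → sigPhi a b k = sigPhi a' b' k + 1 ∧ sigF a b k = some r) := by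
    intro k
    induction k with
    | zero => simp [sigF, sigE]
    | succ k ih =>
      by_cases hk : k = r
      · subst hk
        have h1 := h0 k le_rfl
        have n1 : sigF a b k ≠ some k := fun h => (lt_irrefl _ (sigF_lt h))
        have n2 : sigE a' b' k ≠ some k := fun h => (lt_irrefl _ (sigE_lt h))
        simp only [sigF, sigE, sigPhi]
        constructor
        · intro h
          split_ifs at h with h2 h3
          · exact absurd h n1
          · refine ⟨by omega, ?_⟩
            rw [if_neg (by omega)]
        · intro h
          split_ifs at h with h2
          · exact absurd h n2
          · refine ⟨by omega, ?_⟩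
            rw [if_neg (by omega), if_pos (by omega)]
      · have h1 := ha k hk
        have h2 := hb k hk
        simp only [sigF, sigE, sigPhi]
        constructor
        · intro h
          split_ifs at h with h3 h4
          · obtain ⟨h5, h6⟩ := ih.1 h
            refine ⟨by omega, ?_⟩
            rw [if_pos (by omega), h6]
          · simp at h; omega
        · intro h
          split_ifs at h with h3
          · obtain ⟨h5, h6⟩ := ih.2 h
            refine ⟨by omega, ?_⟩
            rw [if_pos (by omega), h6]
          · simp at h; omega
  exact ⟨fun h => ((key k).1 h).2, fun h => ((key k).2 h).2⟩

/-- Adding `p` to `a i` and `q ≤ p` to `b (i + 1)`, where rows below `i + 1` contribute nothing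
to `b`, does not change the row on which `e_i` acts. -/
theorem sigE_add_top {i p q : ℕ} (hqp : q ≤ p)
    (hb0 : ∀ s, i + 1 < s → b s = 0) (hab : b (i + 1) ≤ a i)
    (ha : ∀ s ≠ i, a' s = a s) (hb : ∀ s ≠ i + 1, b' s = b s)
    (hai : a' i = a i + p) (hbi : b' (i + 1) = b (i + 1) + q) (k : ℕ) :
    sigE a' b' k = sigE a b k := by
  have h0 : ∀ k ≤ i, sigPhi a' b' k = sigPhi a b k := fun k hk =>
    sigPhi_congr fun s hs => ⟨ha s (by omega), hb s (by omega)⟩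
  have h1 : sigPhi a' b' (i + 1) = sigPhi a b (i + 1) + p := by
    have := h0 i le_rfl
    have := hb i (by omega)
    simp only [sigPhi]
    omega
  -- Row i + 1 is thus never selected, before or after the addition. Lower rows are not selected
  -- either, having no letters to lower, and the higher rows see no difference.
  have h3 : b (i + 1) ≤ sigPhi a b (i + 1) := by simp only [sigPhi]; omega
  induction k with
  | zero => rfl
  | succ k ih =>
    simp only [sigE, ih]
    rcases lt_trichotomy k (i + 1) with h | h | h
    · rw [h0 k (by omega), hb k (by omega)]
    · subst h
      rw [if_pos (by omega), if_pos (by omega)]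
    · have e1 := hb0 k h
      have e2 := hb k (by omega)
      rw [if_pos (by omega), if_pos (by omega)]

/-- Adding `z s` letters `i` to each row `s` and as many letters `i + 1` to row `s + 1`, and
any number of letters `i + 1` to row `0`, does not change the row on which `f_i` acts. -/
theorem sigF_add_pairs {z : ℕ → ℕ} (ha : ∀ s, a' s = a s + z s)
    (hb : ∀ s, b' (s + 1) = b (s + 1) + z s) (hz : z k = 0) :
    sigF a' b' (k + 1) = sigF a b (k + 1) := by
  -- The surplus z k of row k is cancelled by the letters added to row k + 1, so only the surplus of
  -- the last row remains visible.
  have h1 : ∀ k, sigPhi a' b' (k + 1) = sigPhi a b (k + 1) + z k := by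
    intro k
    induction k with
    | zero => have := ha 0; simp only [sigPhi]; omega
    | succ k ih =>
      have := ha (k + 1)
      have := hb k
      have e : ∀ a b : ℕ → ℕ,
          sigPhi a b (k + 1 + 1) = a (k + 1) + (sigPhi a b (k + 1) - b (k + 1)) :=
        fun _ _ => rfl
      rw [e, e, ih]
      omega
  -- Positivity is needed: with no unbracketed letter in the original, the new signature could
  -- select an added one. The hypothesis `hz` rules this out at the end.
  have h2 : ∀ k, 0 < sigPhi a b k → sigF a' b' k = sigF a b k := by
    intro k hk
    induction k with
    | zero => simp [sigPhi] at hk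
    | succ k ih =>
      have hc : b' k < sigPhi a' b' k ↔ b k < sigPhi a b k := by
        cases k with
        | zero => simp [sigPhi]
        | succ k => rw [h1, hb]; omega
      simp only [sigPhi] at hk
      simp only [sigF, hc]
      split_ifs with h3 h4 h5 h6
      · exact ih (by omega)
      · rfl
      · omega
      · have := ha k; omega
      · rfl
  rcases Nat.eq_zero_or_pos (sigPhi a b (k + 1)) with h | h
  · rw [sigF_eq_none_iff.2 h, sigF_eq_none_iff, h1, h, hz]
  · exact h2 _ h

end Signature

/-! ### Crystal operators on concatenations of sorted rows -/

section Words

variable {i : ℕ} {l : List ℕ}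

theorem wordPhi_append (hl : l.Pairwise (· ≤ ·)) (v : List ℕ) :
    wordPhi i (l ++ v) = l.count i + (wordPhi i v - l.count (i + 1)) := by
  induction l with
  | nil => simp
  | cons x t ih =>
    rw [List.pairwise_cons] at hl
    rw [List.cons_append, wordPhi, ih hl.2, List.count_cons, List.count_cons]
    simp only [letterPhi, letterEps, beq_iff_eq]
    by_cases h1 : x = i + 1
    · have : t.count i = 0 := List.count_eq_zero.2 fun h => by have := hl.1 i h; omega
      rw [if_neg (by omega), if_pos h1]
      omega
    · rw [if_neg h1]
      omega

theorem wordF_append_of_lt (hl : l.Pairwise (· ≤ ·)) {v : List ℕ}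
    (h : l.count (i + 1) < wordPhi i v) :
    wordF i (l ++ v) = (wordF i v).map (l ++ ·) := by
  induction l with
  | nil => simp
  | cons x t ih =>
    rw [List.pairwise_cons] at hl
    rw [List.count_cons] at h
    rw [List.cons_append, wordF, wordPhi_append hl.2, if_pos, ih hl.2 (by omega)]
    · simp [Function.comp_def]
    · simp only [letterEps, beq_iff_eq] at *
      split_ifs at * <;> omega

theorem wordF_eq_none_iff (w : List ℕ) : wordF i w = none ↔ wordPhi i w = 0 := by
  induction w with
  | nil => simp [wordF, wordPhi]
  | cons x w ih =>
    simp only [wordF, wordPhi]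
    split_ifs with h
    · rw [Option.map_eq_none_iff, ih]
      omega
    · simp only [letterF, letterPhi, Option.map_eq_none_iff]
      split_ifs <;> simp
      omega

/-- The rightmost i of a sorted row has only larger letters after it, so raising it keeps the row
sorted. Writing the change as a permutation with one extra letter on each side avoids deletions from
lists. -/
theorem wordF_append_of_le (hl : l.Pairwise (· ≤ ·)) {v : List ℕ}
    (h : wordPhi i v ≤ l.count (i + 1)) (h0 : 0 < l.count i) :
    ∃ l' : List ℕ, l'.Pairwise (· ≤ ·) ∧ (i :: l').Perm ((i + 1) :: l) ∧
      wordF i (l ++ v) = some (l' ++ v) := by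
  induction l with
  | nil => simp at h0
  | cons x t ih =>
    rw [List.pairwise_cons] at hl
    have hx : x ≤ i := by
      rcases List.mem_cons.1 (List.count_pos_iff.1 h0) with h1 | h1
      · exact h1.ge
      · exact hl.1 i h1
    rw [List.count_cons_of_ne (by omega)] at h
    rw [List.cons_append, wordF, wordPhi_append hl.2]
    have he : letterEps i x = 0 := if_neg (by omega)
    by_cases h1 : 0 < t.count i
    · obtain ⟨l', h2, h3, h4⟩ := ih hl.2 h h1
      refine ⟨x :: l', List.pairwise_cons.2 ⟨fun y hy => ?_, h2⟩, ?_, ?_⟩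
      · rcases List.mem_cons.1 (h3.mem_iff.1 (List.mem_cons_of_mem _ hy)) with h5 | h5
        · omega
        · exact hl.1 y h5
      · exact ((List.Perm.swap x i l').trans (h3.cons x)).trans (List.Perm.swap _ _ _)
      · rw [if_pos (by omega), h4]
        simp
    · have hxi : x = i := by
        rw [List.count_cons] at h0
        by_contra h2
        simp [h2] at h0
        exact h1 (List.count_pos_iff.2 h0)
      subst hxi
      refine ⟨(x + 1) :: t, List.pairwise_cons.2 ⟨fun y hy => ?_, hl.2⟩,
        List.Perm.swap _ _ _, ?_⟩
      · have h2 := hl.1 y hy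
        have h3 : y ≠ x := fun h3 => h1 (List.count_pos_iff.2 (h3 ▸ hy))
        omega
      · rw [if_neg (by omega)]
        simp [letterF]

theorem wordE_append_of_le (hl : l.Pairwise (· ≤ ·)) {v : List ℕ}
    (h : l.count (i + 1) ≤ wordPhi i v) :
    wordE i (l ++ v) = (wordE i v).map (l ++ ·) := by
  induction l with
  | nil => simp
  | cons x t ih =>
    rw [List.pairwise_cons] at hl
    rw [List.count_cons] at h
    rw [List.cons_append, wordE, wordPhi_append hl.2, if_pos, ih hl.2 (by omega)]
    · simp [Function.comp_def]
    · simp only [letterEps, beq_iff_eq] at *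
      split_ifs at * <;> omega

theorem wordE_append_of_lt (hl : l.Pairwise (· ≤ ·)) {v : List ℕ}
    (h : wordPhi i v < l.count (i + 1)) :
    ∃ l' : List ℕ, l'.Pairwise (· ≤ ·) ∧ (i :: l).Perm ((i + 1) :: l') ∧
      wordE i (l ++ v) = some (l' ++ v) := by
  induction l with
  | nil => simp at h
  | cons x t ih =>
    rw [List.pairwise_cons] at hl
    have hx : x ≤ i + 1 := by
      rcases List.mem_cons.1 (List.count_pos_iff.1 (Nat.zero_lt_of_lt h)) with h1 | h1
      · exact h1.ge
      · exact hl.1 _ h1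
    rw [List.cons_append, wordE, wordPhi_append hl.2]
    by_cases hxi : x = i + 1
    · subst hxi
      rw [List.count_cons_self] at h
      have h0 : t.count i = 0 := List.count_eq_zero.2 fun h => by have := hl.1 i h; omega
      have he : letterEps i (i + 1) = 1 := if_pos rfl
      refine ⟨i :: t, List.pairwise_cons.2 ⟨fun y hy => ?_, hl.2⟩, List.Perm.swap _ _ _, ?_⟩
      · have := hl.1 y hy
        omega
      · rw [if_neg (by omega)]
        simp [letterE]
    · have he : letterEps i x = 0 := if_neg hxi
      rw [List.count_cons_of_ne hxi] at h
      obtain ⟨l', h2, h3, h4⟩ := ih hl.2 h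
      refine ⟨x :: l', List.pairwise_cons.2 ⟨fun y hy => ?_, h2⟩, ?_, ?_⟩
      · rcases List.mem_cons.1 (h3.mem_iff.2 (List.mem_cons_of_mem _ hy)) with h5 | h5
        · omega
        · exact hl.1 y h5
      · exact ((List.Perm.swap x i t).trans (h3.cons x)).trans (List.Perm.swap _ _ _)
      · rw [if_pos (by omega), h4]
        simp

/-- The sum of the letters serves as the measure for termination when operators are applied until
they give 0. -/
theorem wordF_sum {w w' : List ℕ} (h : wordF i w = some w') :
    w'.sum = w.sum + 1 ∧ w'.length = w.length := by
  induction w generalizing w' with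
  | nil => simp [wordF] at h
  | cons x w ih =>
    rw [wordF] at h
    split_ifs at h
    · obtain ⟨v, hv, rfl⟩ := Option.map_eq_some_iff.1 h
      have := ih hv
      simp
      omega
    · obtain ⟨v, hv, rfl⟩ := Option.map_eq_some_iff.1 h
      simp only [letterF, Option.ite_none_right_eq_some, Option.some.injEq] at hv
      simp
      omega

theorem wordE_sum {w w' : List ℕ} (h : wordE i w = some w') : w.sum = w'.sum + 1 := by
  induction w generalizing w' with
  | nil => simp [wordE] at h
  | cons x w ih =>
    rw [wordE] at h
    split_ifs at h
    · obtain ⟨v, hv, rfl⟩ := Option.map_eq_some_iff.1 h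
      have := ih hv
      simp
      omega
    · obtain ⟨v, hv, rfl⟩ := Option.map_eq_some_iff.1 h
      simp only [letterE, Option.ite_none_right_eq_some, Option.some.injEq] at hv
      simp
      omega

/-- The concatenation of the rows `R (k - 1), …, R 0`. -/
def rowsWord (R : ℕ → List ℕ) : ℕ → List ℕ
  | 0 => []
  | k + 1 => R k ++ rowsWord R k

theorem rowsWord_congr {R R' : ℕ → List ℕ} {k : ℕ} (h : ∀ s < k, R s = R' s) :
    rowsWord R k = rowsWord R' k := by
  induction k with
  | zero => rfl
  | succ k ih => rw [rowsWord, rowsWord, h k (by omega), ih fun s hs => h s (by omega)]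

theorem rowsWord_update_self {R : ℕ → List ℕ} {k : ℕ} (l : List ℕ) :
    rowsWord (Function.update R k l) (k + 1) = l ++ rowsWord R k := by
  rw [rowsWord, Function.update_self, rowsWord_congr fun s hs => Function.update_of_ne hs.ne _ _]

variable {R : ℕ → List ℕ} {k r : ℕ}

theorem wordPhi_rowsWord (hR : ∀ s, (R s).Pairwise (· ≤ ·)) (k : ℕ) : wordPhi i (rowsWord R k) =
    sigPhi (fun s => (R s).count i) (fun s => (R s).count (i + 1)) k := by
  induction k with
  | zero => rfl
  | succ k ih => rw [rowsWord, wordPhi_append (hR k), ih, sigPhi]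

theorem wordF_rowsWord_of_none (hR : ∀ s, (R s).Pairwise (· ≤ ·))
    (h : sigF (fun s => (R s).count i) (fun s => (R s).count (i + 1)) k = none) :
    wordF i (rowsWord R k) = none := by
  rwa [wordF_eq_none_iff, wordPhi_rowsWord hR, ← sigF_eq_none_iff]

theorem wordF_rowsWord_of_some (hR : ∀ s, (R s).Pairwise (· ≤ ·))
    (h : sigF (fun s => (R s).count i) (fun s => (R s).count (i + 1)) k = some r) :
    ∃ l' : List ℕ, l'.Pairwise (· ≤ ·) ∧ (i :: l').Perm ((i + 1) :: R r) ∧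
      wordF i (rowsWord R k) = some (rowsWord (Function.update R r l') k) := by
  induction k with
  | zero => simp [sigF] at h
  | succ k ih =>
    rw [sigF, ← wordPhi_rowsWord hR] at h
    split_ifs at h with h1 h2
    · obtain ⟨l', h3, h4, h5⟩ := ih h
      have := sigF_lt h
      refine ⟨l', h3, h4, ?_⟩
      rw [rowsWord, rowsWord, wordF_append_of_lt (hR k) h1, h5,
        Function.update_of_ne (by omega)]
      rfl
    · obtain rfl : k = r := by simpa using h
      obtain ⟨l', h3, h4, h5⟩ := wordF_append_of_le (hR k) (not_lt.1 h1) h2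
      exact ⟨l', h3, h4, by rw [rowsWord_update_self, rowsWord, h5]⟩

theorem wordE_rowsWord_of_none (hR : ∀ s, (R s).Pairwise (· ≤ ·))
    (h : sigE (fun s => (R s).count i) (fun s => (R s).count (i + 1)) k = none) :
    wordE i (rowsWord R k) = none := by
  induction k with
  | zero => simp [rowsWord, wordE]
  | succ k ih =>
    rw [sigE, ← wordPhi_rowsWord hR] at h
    split_ifs at h with h1
    rw [rowsWord, wordE_append_of_le (hR k) h1, ih h]
    rfl

theorem wordE_rowsWord_of_some (hR : ∀ s, (R s).Pairwise (· ≤ ·))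
    (h : sigE (fun s => (R s).count i) (fun s => (R s).count (i + 1)) k = some r) :
    ∃ l' : List ℕ, l'.Pairwise (· ≤ ·) ∧ (i :: R r).Perm ((i + 1) :: l') ∧
      wordE i (rowsWord R k) = some (rowsWord (Function.update R r l') k) := by
  induction k with
  | zero => simp [sigE] at h
  | succ k ih =>
    rw [sigE, ← wordPhi_rowsWord hR] at h
    split_ifs at h with h1
    · obtain ⟨l', h3, h4, h5⟩ := ih h
      have := sigE_lt h
      refine ⟨l', h3, h4, ?_⟩
      rw [rowsWord, rowsWord, wordE_append_of_le (hR k) h1, h5,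
        Function.update_of_ne (by omega)]
      rfl
    · obtain rfl : k = r := by simpa using h
      obtain ⟨l', h3, h4, h5⟩ := wordE_append_of_lt (hR k) (not_le.1 h1)
      exact ⟨l', h3, h4, by rw [rowsWord_update_self, rowsWord, h5]⟩

end Words

/-! ### Tableaux and their rows -/

namespace Tab

variable {n : ℕ} {κ ν : YoungDiagram}

theorem row_length (T : Tab n ν) (s : ℕ) : (T.row s).length = ν.rowLen s := by
  simp [row]

theorem row_pairwise (T : Tab n ν) (s : ℕ) : (T.row s).Pairwise (· ≤ ·) := by
  unfold row
  rw [List.pairwise_map]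
  refine (List.pairwise_lt_range).imp_of_mem fun {j j'} _ hj' h => ?_
  exact T.1.row_weak h (YoungDiagram.mem_iff_lt_rowLen.2 (List.mem_range.1 hj'))

theorem mem_row {T : Tab n ν} {s x : ℕ} : x ∈ T.row s ↔ ∃ j, (s, j) ∈ ν ∧ T.1 s j = x := by
  simp [row, YoungDiagram.mem_iff_lt_rowLen]

theorem row_eq_nil {T : Tab n ν} {s : ℕ} (hs : ν.colLen 0 ≤ s) : T.row s = [] := by
  rw [← List.length_eq_zero_iff, row_length]
  by_contra h
  have : (s, 0) ∈ ν := YoungDiagram.mem_iff_lt_rowLen.2 (by omega)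
  have := YoungDiagram.mem_iff_lt_colLen.1 this
  omega

theorem ext_row {T T' : Tab n ν} (h : ∀ s, (T.row s).Perm (T'.row s)) : T = T' := by
  have h1 : ∀ s, T.row s = T'.row s := fun s =>
    (h s).eq_of_pairwise' (row_pairwise _ _) (row_pairwise _ _)
  apply Subtype.ext
  ext s j
  by_cases hc : (s, j) ∈ ν
  · have hj := YoungDiagram.mem_iff_lt_rowLen.1 hc
    have := congrArg (fun l => l[j]?) (h1 s)
    simpa [row, hj] using this
  · rw [T.1.zeros hc, T'.1.zeros hc]

/-- Empty rows are harmless. The freedom in k lets tableaux of shapes κ and κ + ν be compared over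
the same number of rows. -/
theorem reading_eq_rowsWord (T : Tab n ν) {k : ℕ} (hk : ν.colLen 0 ≤ k) :
    T.reading = rowsWord T.row k := by
  induction k, hk using Nat.le_induction with
  | base =>
    unfold reading
    generalize ν.colLen 0 = k
    induction k with
    | zero => rfl
    | succ k ih => rw [rowsWord, ← ih, List.range_succ]; simp
  | succ k hk ih => rw [rowsWord, row_eq_nil hk, ih, List.nil_append]

theorem reading_injective : Function.Injective (reading : Tab n ν → List ℕ) := by
  intro T T' h
  rw [T.reading_eq_rowsWord le_rfl, T'.reading_eq_rowsWord le_rfl] at h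
  have key : ∀ k, rowsWord T.row k = rowsWord T'.row k → ∀ s < k, T.row s = T'.row s := by
    intro k
    induction k with
    | zero => simp
    | succ k ih =>
      intro h s hs
      rw [rowsWord, rowsWord] at h
      obtain ⟨h1, h2⟩ := List.append_inj h (by rw [row_length, row_length])
      rcases Nat.lt_succ_iff_lt_or_eq.1 hs with h' | rfl
      · exact ih h2 s h'
      · exact h1
  refine ext_row fun s => ?_
  rcases lt_or_ge s (ν.colLen 0) with hs | hs
  · rw [key _ h s hs]
  · rw [row_eq_nil hs, row_eq_nil hs]

theorem countP_row_succ_le (T : Tab n ν) (s x : ℕ) :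
    (T.row (s + 1)).countP (fun y => decide (y ≤ x)) ≤
      (T.row s).countP (fun y => decide (y < x)) :=
  countP_row_le T (Nat.lt_succ_self s) x

/-- A sequence of sorted rows that satisfies the column condition is a tableau. -/
theorem exists_row_eq (R : ℕ → List ℕ) (hR : ∀ s, (R s).Pairwise (· ≤ ·))
    (hlen : ∀ s, (R s).length = ν.rowLen s) (hmem : ∀ s, ∀ x ∈ R s, 1 ≤ x ∧ x ≤ n)
    (hcol : ∀ s x, (R (s + 1)).countP (fun y => decide (y ≤ x)) ≤
      (R s).countP (fun y => decide (y < x))) :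
    ∃ T : Tab n ν, ∀ s, T.row s = R s := by
  have hcol' : ∀ s s', s < s' → ∀ x, (R s').countP (fun y => decide (y ≤ x)) ≤
      (R s).countP (fun y => decide (y < x)) := by
    intro s s' h x
    induction s', h using Nat.le_induction with
    | base => exact hcol s x
    | succ s' _ ih =>
      refine (hcol s' x).trans (le_trans ?_ ih)
      exact List.countP_mono_left fun y _ hy => by simp at *; omega
  have hlt : ∀ {s j}, (s, j) ∈ ν → j < (R s).length := fun h => by
    rw [hlen]; exact YoungDiagram.mem_iff_lt_rowLen.1 h
  refine ⟨⟨{ entry := fun s j => (R s).getD j 0, row_weak' := ?_, col_strict' := ?_,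
             zeros' := ?_ }, ?_⟩, ?_⟩
  · intro s j1 j2 hj hc
    have h2 := hlt hc
    have h1 := hj.trans h2
    rw [List.getD_eq_getElem _ _ h1, List.getD_eq_getElem _ _ h2]
    exact List.pairwise_iff_getElem.1 (hR s) j1 j2 h1 h2 hj
  · intro s s' j hs hc
    have h2 := hlt hc
    have h1 := hlt (ν.up_left_mem hs.le le_rfl hc)
    generalize hx : (R s').getD j 0 = x
    have e2 := (lt_countP_iff (fun y => decide (y ≤ x))
      (fun a b hab hb => by simp only [decide_eq_true_eq] at *; omega) _
      (hR s') j h2).2 (by simp only [decide_eq_true_eq]; exact hx.le)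
    have e1 := (lt_countP_iff (fun y => decide (y < x))
      (fun a b hab hb => by simp only [decide_eq_true_eq] at *; omega) _
      (hR s) j h1).1 (lt_of_lt_of_le e2 (hcol' s s' hs x))
    simpa using e1
  · intro s j hc
    rw [List.getD_eq_default]
    rw [hlen]
    exact not_lt.1 fun h => hc (YoungDiagram.mem_iff_lt_rowLen.2 h)
  · intro s j hc
    change 1 ≤ (R s).getD j 0 ∧ (R s).getD j 0 ≤ n
    rw [List.getD_eq_getElem _ _ (hlt hc)]
    exact hmem s _ (List.getElem_mem _)
  · intro s
    apply List.ext_getElem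
    · exact (row_length _ s).trans (hlen s).symm
    · intro j h1 h2
      simp only [row, List.getElem_map, List.getElem_range]
      exact List.getD_eq_getElem _ _ h2

theorem row_star (T : Tab n κ) (T' : Tab n ν) (s : ℕ) :
    ((star T T').row s).Perm (T.row s ++ T'.row s) := by
  have h : (star T T').row s = starRow T T' s := by
    have hl : (shapeAdd κ ν).rowLen s = (starRow T T' s).length := by
      rw [length_starRow]
      refine eq_of_forall_lt_iff fun j => ?_
      rw [← YoungDiagram.mem_iff_lt_rowLen, mem_shapeAdd]
    apply List.ext_getElem
    · rw [row_length, hl]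
    · intro j h1 h2
      simp only [row, List.getElem_map, List.getElem_range]
      exact List.getD_eq_getElem _ _ h2
  rw [h]
  exact List.perm_insertionSort _ _

theorem star_left_injective (T : Tab n ν) : Function.Injective (starMap κ T) := by
  intro x y h
  refine ext_row fun s => ?_
  have h1 := row_star x T s
  have h2 : (star x T) = star y T := h
  rw [h2] at h1
  exact (List.perm_append_right_iff _).1 (h1.symm.trans (row_star y T s))

/-- `T'` is obtained from `T` by changing a letter `i` in row `r` to `i + 1`. -/
def Raise (i r : ℕ) (T T' : Tab n ν) : Prop :=
  (∀ s ≠ r, T'.row s = T.row s) ∧ (i :: T'.row r).Perm ((i + 1) :: T.row r)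

namespace Raise

variable {i r : ℕ} {T T' T'' : Tab n ν}

theorem right_unique (h : Raise i r T T') (h' : Raise i r T T'') : T' = T'' := by
  refine ext_row fun s => ?_
  by_cases hs : s = r
  · subst hs
    exact (List.perm_cons _).1 (h.2.trans h'.2.symm)
  · rw [h.1 s hs, h'.1 s hs]

theorem left_unique (h : Raise i r T T'') (h' : Raise i r T' T'') : T = T' := by
  refine ext_row fun s => ?_
  by_cases hs : s = r
  · subst hs
    exact (List.perm_cons _).1 (h.2.symm.trans h'.2)
  · rw [← h.1 s hs, ← h'.1 s hs]

theorem count_self (h : Raise i r T T') : (T.row r).count i = (T'.row r).count i + 1 := by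
  have := h.2.count_eq i
  rw [List.count_cons_self, List.count_cons_of_ne (by omega)] at this
  exact this.symm

theorem count_succ (h : Raise i r T T') :
    (T'.row r).count (i + 1) = (T.row r).count (i + 1) + 1 := by
  have := h.2.count_eq (i + 1)
  rwa [List.count_cons_self, List.count_cons_of_ne (by omega)] at this

theorem ne (h : Raise i r T T') : T ≠ T' := by
  rintro rfl
  have := h.count_self
  omega

/-- Rows of a star product are multiset unions, so a change of one letter in the left factor is the
same change in the product. -/
theorem star (h : Raise i r T T') (S : Tab n κ) : Raise i r (star T S) (star T' S) := by
  constructor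
  · intro s hs
    refine List.Perm.eq_of_pairwise' (row_pairwise _ _) (row_pairwise _ _) ?_
    refine (row_star _ _ _).trans ?_
    rw [h.1 s hs]
    exact (row_star _ _ _).symm
  · refine ((row_star _ _ _).cons _).trans (List.Perm.trans ?_ ((row_star _ _ _).cons _).symm)
    exact h.2.append_right _

end Raise

theorem countP_le_eq (l : List ℕ) (x : ℕ) :
    l.countP (fun y => decide (y ≤ x)) = l.countP (fun y => decide (y < x)) + l.count x := by
  induction l with
  | nil => rfl
  | cons y l ih =>
    rw [List.countP_cons, List.countP_cons, List.count_cons, ih]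
    simp only [decide_eq_true_eq, beq_iff_eq]
    split_ifs <;> omega

theorem countP_lt_succ (l : List ℕ) (x : ℕ) :
    l.countP (fun y => decide (y < x + 1)) = l.countP (fun y => decide (y ≤ x)) := by
  simp only [Nat.lt_succ_iff]

/-- The row counts of the letter `x`. -/
def cnt (T : Tab n ν) (x s : ℕ) : ℕ := (T.row s).count x

theorem exists_update (T : Tab n ν) {r : ℕ} {l : List ℕ} (hl : l.Pairwise (· ≤ ·))
    (hlen : l.length = (T.row r).length) (hmem : ∀ x ∈ l, 1 ≤ x ∧ x ≤ n)
    (h1 : ∀ x, (T.row (r + 1)).countP (fun y => decide (y ≤ x)) ≤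
      l.countP (fun y => decide (y < x)))
    (h2 : ∀ s, r = s + 1 → ∀ x, l.countP (fun y => decide (y ≤ x)) ≤
      (T.row s).countP (fun y => decide (y < x))) :
    ∃ T' : Tab n ν, ∀ s, T'.row s = Function.update T.row r l s := by
  refine exists_row_eq _ (fun s => ?_) (fun s => ?_) (fun s => ?_) (fun s x => ?_)
  · rw [Function.update_apply]; split_ifs
    · exact hl
    · exact row_pairwise _ _
  · rw [Function.update_apply]; split_ifs with h
    · rw [hlen, row_length, h]
    · exact row_length _ _
  · rw [Function.update_apply]; split_ifs with h
    · exact hmem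
    · intro x hx
      obtain ⟨j, hj, rfl⟩ := mem_row.1 hx
      exact T.2 s j hj
  · rw [Function.update_apply, Function.update_apply]
    split_ifs with h3 h4 h4
    · omega
    · exact h2 s h3.symm x
    · subst h4; exact h1 x
    · exact T.countP_row_succ_le s x

/-- The column condition can only fail between rows r and r + 1 at the threshold i + 1, where row r
loses one smaller letter. The inequality `hr` supplies the needed slack of one. -/
theorem exists_raise_of_lt (T : Tab n ν) {i r : ℕ} (hi : i < n)
    (hr : T.cnt (i + 1) (r + 1) < T.cnt i r) {l : List ℕ} (hl : l.Pairwise (· ≤ ·))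
    (hp : (i :: l).Perm ((i + 1) :: T.row r)) :
    ∃ T' : Tab n ν, ∀ s, T'.row s = Function.update T.row r l s := by
  unfold cnt at hr
  refine T.exists_update hl (by simpa using hp.length_eq) (fun x hx => ?_) (fun x => ?_)
    (fun s hs x => ?_)
  · rcases List.mem_cons.1 (hp.mem_iff.1 (List.mem_cons_of_mem _ hx)) with rfl | h
    · omega
    · obtain ⟨j, hj, rfl⟩ := mem_row.1 h
      exact T.2 r j hj
  · have h1 := T.countP_row_succ_le r x
    have h2 := hp.countP_eq (fun y => decide (y < x))
    rw [List.countP_cons, List.countP_cons] at h2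
    by_cases hx : x = i + 1
    · subst hx
      have h3 := countP_le_eq (T.row (r + 1)) (i + 1)
      have h4 := countP_le_eq (T.row r) i
      have h5 := T.countP_row_succ_le r i
      rw [countP_lt_succ] at h2 h3
      simp only [decide_eq_true_eq, lt_add_iff_pos_right, zero_lt_one, if_true, lt_irrefl,
        if_false, add_zero, countP_lt_succ] at h2 ⊢
      omega
    · simp only [decide_eq_true_eq] at h2
      split_ifs at h2 <;> omega
  · subst hs
    have h1 := T.countP_row_succ_le s x
    have h2 := hp.countP_eq (fun y => decide (y ≤ x))
    rw [List.countP_cons, List.countP_cons] at h2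
    simp only [decide_eq_true_eq] at h2
    split_ifs at h2 <;> omega

/-- Dual to raising: the only threat is the row above at the threshold i, where row r gains one
letter. -/
theorem exists_lower_of_lt (T : Tab n ν) {i r : ℕ} (hi : 1 ≤ i) (hi' : i < n)
    (hr : ∀ s, r = s + 1 → T.cnt i s < T.cnt (i + 1) r) {l : List ℕ} (hl : l.Pairwise (· ≤ ·))
    (hp : (i :: T.row r).Perm ((i + 1) :: l)) :
    ∃ T' : Tab n ν, ∀ s, T'.row s = Function.update T.row r l s := by
  unfold cnt at hr
  refine T.exists_update hl (by simpa using hp.length_eq.symm) (fun x hx => ?_) (fun x => ?_)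
    (fun s hs x => ?_)
  · rcases List.mem_cons.1 (hp.mem_iff.2 (List.mem_cons_of_mem _ hx)) with rfl | h
    · omega
    · obtain ⟨j, hj, rfl⟩ := mem_row.1 h
      exact T.2 r j hj
  · have h1 := T.countP_row_succ_le r x
    have h2 := hp.countP_eq (fun y => decide (y < x))
    rw [List.countP_cons, List.countP_cons] at h2
    simp only [decide_eq_true_eq] at h2
    split_ifs at h2 <;> omega
  · subst hs
    have hr := hr s rfl
    have h1 := T.countP_row_succ_le s x
    have h2 := hp.countP_eq (fun y => decide (y ≤ x))
    rw [List.countP_cons, List.countP_cons] at h2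
    by_cases hx : x = i
    · subst hx
      have h3 := countP_le_eq (T.row (s + 1)) (x + 1)
      have h4 := countP_le_eq (T.row s) x
      have h5 := T.countP_row_succ_le s (x + 1)
      rw [countP_lt_succ] at h3 h5
      simp at h2
      omega
    · simp only [decide_eq_true_eq] at h2
      split_ifs at h2 <;> omega

/-! ### Crystal operators on tableaux in terms of signatures -/

section Operators

variable {i : CrystalIndex n} {T T' : Tab n ν} {k : ℕ}

theorem f_eq_some_iff_reading : f i T = some T' ↔ wordF i T.reading = some T'.reading := by
  unfold f
  constructor
  · intro h
    split_ifs at h with h1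
    rw [h1.choose_spec, ← Option.some.inj h]
  · intro h
    have h1 : ∃ T' : Tab n ν, wordF i T.reading = some T'.reading := ⟨T', h⟩
    rw [dif_pos h1]
    congr 1
    exact reading_injective (Option.some.inj (h1.choose_spec.symm.trans h))

theorem e_eq_some_iff_reading : e i T = some T' ↔ wordE i T.reading = some T'.reading := by
  unfold e
  constructor
  · intro h
    split_ifs at h with h1
    rw [h1.choose_spec, ← Option.some.inj h]
  · intro h
    have h1 : ∃ T' : Tab n ν, wordE i T.reading = some T'.reading := ⟨T', h⟩
    rw [dif_pos h1]
    congr 1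
    exact reading_injective (Option.some.inj (h1.choose_spec.symm.trans h))

theorem exists_f_of_sigF {r : ℕ} (hk : ν.colLen 0 ≤ k)
    (h : sigF (T.cnt i) (T.cnt (i + 1)) k = some r) :
    ∃ T', Raise i r T T' ∧ f i T = some T' := by
  obtain ⟨l, h1, h2, h3⟩ := wordF_rowsWord_of_some T.row_pairwise h
  have h4 := sigF_some h
  obtain ⟨T', hT'⟩ := T.exists_raise_of_lt i.2.2 (r := r) (by
    -- If r is the last of the k rows, the row below it is empty because k bounds the number of rows
    -- of the shape.
    by_cases h5 : r + 1 < k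
    · exact h4.2 h5
    · have : T.cnt (i + 1) (r + 1) = 0 := by rw [cnt, row_eq_nil (by omega)]; rfl
      omega) h1 h2
  refine ⟨T', ⟨fun s hs => by rw [hT', Function.update_of_ne hs], ?_⟩, ?_⟩
  · rw [hT', Function.update_self]; exact h2
  · rw [f_eq_some_iff_reading, T.reading_eq_rowsWord hk, h3, T'.reading_eq_rowsWord hk,
      rowsWord_congr fun s _ => hT' s]

theorem exists_e_of_sigE {r : ℕ} (hk : ν.colLen 0 ≤ k)
    (h : sigE (T.cnt i) (T.cnt (i + 1)) k = some r) :
    ∃ T', Raise i r T' T ∧ e i T = some T' := by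
  obtain ⟨l, h1, h2, h3⟩ := wordE_rowsWord_of_some T.row_pairwise h
  have h4 := sigE_some h
  obtain ⟨T', hT'⟩ := T.exists_lower_of_lt i.2.1 i.2.2 (r := r) (by
    rintro s rfl
    rw [sigPhi] at h4
    omega) h1 h2
  refine ⟨T', ⟨fun s hs => by rw [hT', Function.update_of_ne hs], ?_⟩, ?_⟩
  · rw [hT', Function.update_self]; exact h2
  · rw [e_eq_some_iff_reading, T.reading_eq_rowsWord hk, h3, T'.reading_eq_rowsWord hk,
      rowsWord_congr fun s _ => hT' s]

theorem f_eq_none_iff (hk : ν.colLen 0 ≤ k) :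
    f i T = none ↔ sigF (T.cnt i) (T.cnt (i + 1)) k = none := by
  constructor
  · intro h
    by_contra h1
    obtain ⟨r, hr⟩ := Option.ne_none_iff_exists'.1 h1
    obtain ⟨T', -, h2⟩ := exists_f_of_sigF hk hr
    simp [h2] at h
  · intro h
    by_contra h1
    obtain ⟨T', hT'⟩ := Option.ne_none_iff_exists'.1 h1
    rw [f_eq_some_iff_reading, T.reading_eq_rowsWord hk,
      wordF_rowsWord_of_none T.row_pairwise h] at hT'
    simp at hT'

theorem e_eq_none_iff (hk : ν.colLen 0 ≤ k) :
    e i T = none ↔ sigE (T.cnt i) (T.cnt (i + 1)) k = none := by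
  constructor
  · intro h
    by_contra h1
    obtain ⟨r, hr⟩ := Option.ne_none_iff_exists'.1 h1
    obtain ⟨T', -, h2⟩ := exists_e_of_sigE hk hr
    simp [h2] at h
  · intro h
    by_contra h1
    obtain ⟨T', hT'⟩ := Option.ne_none_iff_exists'.1 h1
    rw [e_eq_some_iff_reading, T.reading_eq_rowsWord hk,
      wordE_rowsWord_of_none T.row_pairwise h] at hT'
    simp at hT'

/-- The operator never leaves the set of tableaux, so it splits into a choice of row, which depends
on counts alone, and a change of one letter, which is unique. -/
theorem f_eq_some_iff (hk : ν.colLen 0 ≤ k) :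
    f i T = some T' ↔ ∃ r, sigF (T.cnt i) (T.cnt (i + 1)) k = some r ∧ Raise i r T T' := by
  constructor
  · intro h
    have h1 : f i T ≠ none := by simp [h]
    rw [Ne, f_eq_none_iff hk] at h1
    obtain ⟨r, hr⟩ := Option.ne_none_iff_exists'.1 h1
    obtain ⟨S, h2, h3⟩ := exists_f_of_sigF hk hr
    obtain rfl : S = T' := Option.some.inj (h3.symm.trans h)
    exact ⟨r, hr, h2⟩
  · rintro ⟨r, hr, h⟩
    obtain ⟨S, h2, h3⟩ := exists_f_of_sigF hk hr
    rw [h3, h2.right_unique h]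

theorem e_eq_some_iff (hk : ν.colLen 0 ≤ k) :
    e i T = some T' ↔ ∃ r, sigE (T.cnt i) (T.cnt (i + 1)) k = some r ∧ Raise i r T' T := by
  constructor
  · intro h
    have h1 : e i T ≠ none := by simp [h]
    rw [Ne, e_eq_none_iff hk] at h1
    obtain ⟨r, hr⟩ := Option.ne_none_iff_exists'.1 h1
    obtain ⟨S, h2, h3⟩ := exists_e_of_sigE hk hr
    obtain rfl : S = T' := Option.some.inj (h3.symm.trans h)
    exact ⟨r, hr, h2⟩
  · rintro ⟨r, hr, h⟩
    obtain ⟨S, h2, h3⟩ := exists_e_of_sigE hk hr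
    rw [h3, h2.left_unique h]

theorem f_eq_some_iff_e : f i T = some T' ↔ e i T' = some T := by
  rw [f_eq_some_iff le_rfl, e_eq_some_iff le_rfl]
  refine exists_congr fun r => and_congr_left fun h => ?_
  refine sigF_iff_sigE (fun s hs => ?_) (fun s hs => ?_) h.count_self h.count_succ
  · simp only [cnt, h.1 s hs]
  · simp only [cnt, h.1 s hs]

theorem ne_of_e_eq_some (h : e i T = some T') : T' ≠ T := by
  obtain ⟨r, -, h⟩ := (e_eq_some_iff le_rfl).1 h
  exact h.ne

theorem ne_of_f_eq_some (h : f i T = some T') : T' ≠ T :=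
  (ne_of_e_eq_some (f_eq_some_iff_e.1 h)).symm

end Operators

end Tab

/-! ### Highest and lowest weight vectors -/

namespace Tab

variable {n : ℕ} {κ ν : YoungDiagram}

theorem exists_act_eq_some_iff {g : CrystalIndex n → Tab n ν → Option (Tab n ν)}
    {T T' : Tab n ν} : (∃ w : FreeMonoid (CrystalIndex n), act g w.toList T = some T') ↔
      Relation.ReflTransGen (fun x y => ∃ i, g i x = some y) T T' := by
  constructor
  · rintro ⟨w, hw⟩
    generalize w.toList = w at hw
    induction w generalizing T' with
    | nil =>
      obtain rfl : T = T' := by simpa [act] using hw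
      rfl
    | cons i w ih =>
      obtain ⟨S, h1, h2⟩ := Option.bind_eq_some_iff.1 hw
      exact (ih h1).tail ⟨i, h2⟩
  · intro h
    induction h with
    | refl => exact ⟨1, rfl⟩
    | tail _ h ih =>
      obtain ⟨w, hw⟩ := ih
      obtain ⟨i, hi⟩ := h
      refine ⟨FreeMonoid.of i * w, ?_⟩
      change (act g w.toList T).bind (g i) = _
      rw [hw]
      exact hi

theorem mem_E_iff {T T' : Tab n ν} :
    T' ∈ E T ↔ Relation.ReflTransGen (fun x y => ∃ i, e i x = some y) T T' :=
  exists_act_eq_some_iff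

theorem mem_F_iff {T T' : Tab n ν} :
    T' ∈ F T ↔ Relation.ReflTransGen (fun x y => ∃ i, f i x = some y) T T' :=
  exists_act_eq_some_iff

theorem mem_E_iff_mem_F {T T' : Tab n ν} : T' ∈ E T ↔ T ∈ F T' := by
  rw [mem_E_iff, mem_F_iff, ← Relation.reflTransGen_swap]
  have : Function.swap (fun x y : Tab n ν => ∃ i, e i x = some y) =
      fun x y => ∃ i, f i x = some y := by
    funext x y
    simp only [Function.swap, f_eq_some_iff_e]
  rw [this]

/-- A loop e_i T = T is impossible since e_i changes letter counts, so a singleton E(T) forces every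
e_i to vanish on T. -/
theorem isHighestWeight_iff {T : Tab n ν} : T.IsHighestWeight ↔ ∀ i, e i T = none := by
  constructor
  · intro h i
    by_contra h1
    obtain ⟨T', hT'⟩ := Option.ne_none_iff_exists'.1 h1
    have h2 : T' ∈ E T := mem_E_iff.2 (.single ⟨i, hT'⟩)
    rw [h] at h2
    exact ne_of_e_eq_some hT' h2
  · intro h
    refine Set.eq_singleton_iff_unique_mem.2 ⟨mem_E_iff.2 .refl, fun T' hT' => ?_⟩
    rcases (mem_E_iff.1 hT').cases_head with h1 | ⟨S, ⟨i, hi⟩, -⟩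
    · exact h1.symm
    · simp [h i] at hi

theorem isLowestWeight_iff {T : Tab n ν} : T.IsLowestWeight ↔ ∀ i, f i T = none := by
  constructor
  · intro h i
    by_contra h1
    obtain ⟨T', hT'⟩ := Option.ne_none_iff_exists'.1 h1
    have h2 : T' ∈ F T := mem_F_iff.2 (.single ⟨i, hT'⟩)
    rw [h] at h2
    exact ne_of_f_eq_some hT' h2
  · intro h
    refine Set.eq_singleton_iff_unique_mem.2 ⟨mem_F_iff.2 .refl, fun T' hT' => ?_⟩
    rcases (mem_F_iff.1 hT').cases_head with h1 | ⟨S, ⟨i, hi⟩, -⟩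
    · exact h1.symm
    · simp [h i] at hi

theorem succ_le_of_mem_row {T : Tab n ν} {s x : ℕ} (h : x ∈ T.row s) : s + 1 ≤ x := by
  obtain ⟨j, hj, rfl⟩ := mem_row.1 h
  clear h
  induction s with
  | zero => exact (T.2 0 j hj).1
  | succ s ih =>
    have h1 := ih (ν.up_left_mem (Nat.le_succ s) le_rfl hj)
    exact Nat.succ_le_of_lt (h1.trans_lt (T.1.col_strict (Nat.lt_succ_self s) hj))

theorem cnt_eq_zero_of_le (T : Tab n ν) {s x : ℕ} (h : x ≤ s) : T.cnt x s = 0 :=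
  List.count_eq_zero.2 fun hx => by have := succ_le_of_mem_row hx; omega

theorem cnt_eq_zero_of_lt (T : Tab n ν) {s x : ℕ} (h : n < x) : T.cnt x s = 0 :=
  List.count_eq_zero.2 fun hx => by
    obtain ⟨j, hj, rfl⟩ := mem_row.1 hx
    have := (T.2 s j hj).2
    omega

theorem cnt_eq_zero_of_colLen_le (T : Tab n ν) {s x : ℕ} (h : ν.colLen 0 ≤ s) :
    T.cnt x s = 0 := by
  rw [cnt, row_eq_nil h]; rfl

theorem countP_le_succ (T : Tab n ν) (s x : ℕ) :
    (T.row s).countP (fun y => decide (y ≤ x + 1)) =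
      (T.row s).countP (fun y => decide (y ≤ x)) + T.cnt (x + 1) s := by
  rw [countP_le_eq, countP_lt_succ, cnt]

theorem countP_row_le_eq_zero (T : Tab n ν) {s x : ℕ} (h : x ≤ s) :
    (T.row s).countP (fun y => decide (y ≤ x)) = 0 := by
  rw [List.countP_eq_zero]
  intro y hy
  have := succ_le_of_mem_row hy
  simp only [decide_eq_true_eq]
  omega

/-- The letters `i + 1` in row `i` lie below letters `i`. -/
theorem cnt_succ_diag_le (T : Tab n ν) (s : ℕ) : T.cnt (s + 2) (s + 1) ≤ T.cnt (s + 1) s := by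
  have h := T.countP_row_succ_le s (s + 1 + 1)
  rw [countP_lt_succ, countP_le_succ, countP_le_succ T s, T.countP_row_le_eq_zero le_rfl,
    T.countP_row_le_eq_zero le_rfl, zero_add, zero_add] at h
  exact h

theorem row_A (hν : ν.colLen 0 ≤ n) (s : ℕ) :
    (A n ν hν).row s = List.replicate (ν.rowLen s) (s + 1) := by
  rw [List.eq_replicate_iff]
  refine ⟨row_length _ _, fun x hx => ?_⟩
  obtain ⟨j, hj, rfl⟩ := mem_row.1 hx
  exact if_pos hj

theorem cnt_A (hν : ν.colLen 0 ≤ n) (x s : ℕ) :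
    (A n ν hν).cnt x s = if s + 1 = x then ν.rowLen s else 0 := by
  rw [cnt, row_A, List.count_replicate]
  simp only [beq_iff_eq]

theorem forall_e_eq_none_iff (hν : ν.colLen 0 ≤ n) {T : Tab n ν} :
    (∀ i, e i T = none) ↔ T = A n ν hν := by
  constructor
  · intro h
    have key : ∀ s, ∀ x ∈ T.row s, x = s + 1 := by
      intro s
      induction s using Nat.strong_induction_on with
      | _ s ih =>
        intro x hx
        by_contra hne
        have h1 := succ_le_of_mem_row hx
        obtain ⟨j, hj, hjx⟩ := mem_row.1 hx
        have h2 := (T.2 s j hj).2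
        have hs : s < ν.colLen 0 := by
          by_contra hs
          simp [row_eq_nil (not_lt.1 hs)] at hx
        obtain ⟨i, rfl⟩ : ∃ i, x = i + 1 := ⟨x - 1, by omega⟩
        have h3 := (e_eq_none_iff le_rfl).1 (h ⟨i, by omega, by omega⟩)
        have h4 := sigE_eq_none_iff.1 h3 s hs
        -- By induction the rows above s contain only letters at most s, while i > s. Hence nothing
        -- can bracket the letter i + 1 in row s, and e_i would act.
        have h5 : sigPhi (T.cnt i) (T.cnt (i + 1)) s = 0 := by
          have : ∀ k ≤ s, sigPhi (T.cnt i) (T.cnt (i + 1)) k = 0 := by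
            intro k
            induction k with
            | zero => intro _; rfl
            | succ k ihk =>
              intro hk
              have h6 : T.cnt i k = 0 := List.count_eq_zero.2 fun h7 => by
                have := ih k hk i h7
                omega
              rw [sigPhi, h6, ihk (by omega)]
              omega
          exact this s le_rfl
        have h6 : 0 < T.cnt (i + 1) s := List.count_pos_iff.2 hx
        simp only at h4
        omega
    refine ext_row fun s => ?_
    rw [row_A, List.eq_replicate_iff.2 ⟨row_length T s, key s⟩]
  · rintro rfl i
    rw [e_eq_none_iff le_rfl, sigE_eq_none_iff]
    intro s _
    rw [cnt_A]
    split_ifs with h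
    · obtain ⟨i, hi, hi'⟩ := i
      simp only at h
      obtain ⟨t, rfl⟩ : ∃ t, i = t + 1 := ⟨i - 1, by omega⟩
      obtain rfl : s = t + 1 := by omega
      -- The letters t + 2 of row t + 1 are all bracketed with the letters t + 1 of row t, which is
      -- at least as long.
      rw [sigPhi, cnt_A, if_pos rfl]
      have := ν.rowLen_anti t (t + 1) (by omega)
      omega
    · omega

/-- Counting over a common range of columns allows two rows to be compared column by column. Cells
outside the shape carry the default entry 0, hence `hx`. -/
theorem cnt_eq_card (T : Tab n ν) {x s m : ℕ} (hx : x ≠ 0) (hm : ν.rowLen s ≤ m) :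
    T.cnt x s = ((Finset.range m).filter fun j => T.1 s j = x).card := by
  have h1 : T.cnt x s = ((Finset.range (ν.rowLen s)).filter fun j => T.1 s j = x).card := by
    rw [cnt, row, List.count, List.countP_map, Finset.card_def, Finset.filter_val,
      Finset.range_val, ← Multiset.countP_eq_card_filter, Multiset.range, Multiset.coe_countP]
    congr 1
  rw [h1]
  congr 1
  ext j
  simp only [Finset.mem_filter, Finset.mem_range]
  refine ⟨fun h => ⟨by omega, h.2⟩, fun h => ⟨?_, h.2⟩⟩
  by_contra h2
  have := T.1.zeros (i := s) (j := j) fun h3 => h2 (YoungDiagram.mem_iff_lt_rowLen.1 h3)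
  omega

theorem cnt_Z (hν : ν.colLen 0 ≤ n) {i : ℕ} (hi : 1 ≤ i) (hi' : i < n) (s : ℕ) :
    (Z n ν hν).cnt (i + 1) (s + 1) = (Z n ν hν).cnt i s := by
  rw [cnt_eq_card _ (by omega) (ν.rowLen_anti s (s + 1) (by omega)),
    cnt_eq_card _ (by omega) le_rfl]
  congr 1
  refine Finset.filter_congr fun j _ => ?_
  change (if (s + 1, j) ∈ ν then n - ν.colLen j + (s + 1 + 1) else 0) = i + 1 ↔
    (if (s, j) ∈ ν then n - ν.colLen j + (s + 1) else 0) = i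
  have := ν.colLen_anti 0 j (Nat.zero_le _)
  split_ifs with h1 h2 h2 <;> rw [YoungDiagram.mem_iff_lt_colLen] at h1 h2
  · omega
  · omega
  -- Here the column ends in row s, where its entry is n, and i < n.
  · rw [false_iff]; omega
  · rw [false_iff]; omega

/-- A tableau with the shift property of `Z` is determined by its shape. -/
theorem eq_of_cnt_shift {T T' : Tab n ν}
    (h : ∀ i, 1 ≤ i → i < n → ∀ s, T.cnt (i + 1) (s + 1) = T.cnt i s)
    (h' : ∀ i, 1 ≤ i → i < n → ∀ s, T'.cnt (i + 1) (s + 1) = T'.cnt i s) : T = T' := by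
  -- Moving one row down and one letter up preserves the number of letters at most i. After m = n -
  -- i moves every letter counts, leaving a row length.
  have key : ∀ S : Tab n ν, (∀ i, 1 ≤ i → i < n → ∀ s, S.cnt (i + 1) (s + 1) = S.cnt i s) →
      ∀ m i s, i + m = n →
        (S.row s).countP (fun y => decide (y ≤ i)) = ν.rowLen (s + m) := by
    intro S hS
    have h1 : ∀ i, i < n → ∀ s, (S.row (s + 1)).countP (fun y => decide (y ≤ i + 1)) =
        (S.row s).countP (fun y => decide (y ≤ i)) := by
      intro i hi s
      induction i with
      | zero =>
        rw [S.countP_row_le_eq_zero (by omega), S.countP_row_le_eq_zero (by omega)]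
      | succ i ih =>
        rw [countP_le_succ, ih (by omega), hS (i + 1) (by omega) hi, ← countP_le_succ]
    intro m
    induction m with
    | zero =>
      intro i s hi
      rw [← row_length S]
      refine List.countP_eq_length.2 fun x hx => ?_
      obtain ⟨j, hj, rfl⟩ := mem_row.1 hx
      simpa using (S.2 s j hj).2.trans hi.ge
    | succ m ih =>
      intro i s hi
      rw [← h1 i (by omega), ih (i + 1) (s + 1) (by omega)]
      congr 1
      omega
  refine ext_row fun s => List.perm_iff_count.2 fun x => ?_
  change T.cnt x s = T'.cnt x s
  rcases Nat.eq_zero_or_pos x with rfl | hx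
  · rw [T.cnt_eq_zero_of_le (Nat.zero_le _), T'.cnt_eq_zero_of_le (Nat.zero_le _)]
  rcases lt_or_ge n x with hn | hn
  · rw [T.cnt_eq_zero_of_lt hn, T'.cnt_eq_zero_of_lt hn]
  obtain ⟨y, rfl⟩ : ∃ y, x = y + 1 := ⟨x - 1, by omega⟩
  have e1 := countP_le_succ T s y
  have e2 := countP_le_succ T' s y
  rw [key _ h (n - y) y s (by omega), key _ h (n - (y + 1)) (y + 1) s (by omega)] at e1
  rw [key _ h' (n - y) y s (by omega), key _ h' (n - (y + 1)) (y + 1) s (by omega)] at e2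
  omega

theorem forall_f_eq_none_iff (hν : ν.colLen 0 ≤ n) {T : Tab n ν} :
    (∀ i, f i T = none) ↔ T = Z n ν hν := by
  constructor
  · intro h
    refine eq_of_cnt_shift ?_ fun i hi hi' s => cnt_Z hν hi hi' s
    -- Induction from the bottom row upwards, m bounding the number of rows from s on.
    suffices H : ∀ m s, ν.colLen 0 ≤ s + m → ∀ i, 1 ≤ i → i < n →
        T.cnt (i + 1) (s + 1) = T.cnt i s from
      fun i hi hi' s => H (ν.colLen 0) s (by omega) i hi hi'
    intro m
    induction m with
    | zero =>
      intro s hs i _ _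
      rw [T.cnt_eq_zero_of_colLen_le (by omega), T.cnt_eq_zero_of_colLen_le (by omega)]
    | succ m ih =>
      intro s hs
      have h1 : ∀ i, 1 ≤ i → i < n → T.cnt i s ≤ T.cnt (i + 1) (s + 1) := by
        intro i hi hi'
        -- Below row s + 1 the counts already shift, so they cancel. Letters i of row s in excess of
        -- the letters i + 1 of row s + 1 would stay unbracketed to the end, but there φ_i is 0.
        have h2 : ∀ t, T.cnt i s + T.cnt i (s + 1 + t) ≤
            sigPhi (T.cnt i) (T.cnt (i + 1)) (s + 1 + t + 1) + T.cnt (i + 1) (s + 1) := by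
          intro t
          induction t with
          | zero => simp only [sigPhi, add_zero]; omega
          | succ t iht =>
            have := ih (s + 1 + t) (by omega) i hi hi'
            have e : sigPhi (T.cnt i) (T.cnt (i + 1)) (s + 1 + (t + 1) + 1) =
              T.cnt i (s + 1 + (t + 1)) + (sigPhi (T.cnt i) (T.cnt (i + 1)) (s + 1 + t + 1) -
                T.cnt (i + 1) (s + 1 + t + 1)) := rfl
            rw [e]
            omega
        have h3 := (f_eq_none_iff (k := s + 1 + ν.colLen 0 + 1) (by omega)).1 (h ⟨i, hi, hi'⟩)
        rw [sigF_eq_none_iff] at h3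
        have h4 := h2 (ν.colLen 0)
        simp only at h3
        omega
      have h2 : ∀ i < n, (T.row s).countP (fun y => decide (y ≤ i)) ≤
          (T.row (s + 1)).countP (fun y => decide (y ≤ i + 1)) := by
        intro i hi
        induction i with
        | zero =>
          rw [T.countP_row_le_eq_zero (Nat.zero_le _)]
          exact Nat.zero_le _
        | succ i ihi =>
          have := ihi (by omega)
          have := h1 (i + 1) (by omega) hi
          rw [countP_le_succ, countP_le_succ _ _ (i + 1)]
          omega
      intro i hi hi'
      obtain ⟨j, rfl⟩ : ∃ j, i = j + 1 := ⟨i - 1, by omega⟩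
      -- Vanishing of the f_i bounds the counts from below and column strictness bounds them from
      -- above; subtracting `h3` from `h4` forces equality.
      have h3 := h2 j (by omega)
      have h4 := T.countP_row_succ_le s (j + 1 + 1)
      have h5 := h1 _ hi hi'
      rw [countP_lt_succ, countP_le_succ, countP_le_succ] at h4
      rw [countP_le_succ] at h3
      rw [countP_le_succ] at h4
      omega
  · rintro rfl ⟨i, hi, hi'⟩
    rw [f_eq_none_iff (k := ν.colLen 0 + 1) (by omega), sigF_eq_none_iff]
    have h1 : ∀ k, sigPhi ((Z n ν hν).cnt i) ((Z n ν hν).cnt (i + 1)) (k + 1) =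
        (Z n ν hν).cnt i k := by
      intro k
      induction k with
      | zero => simp [sigPhi]
      | succ k ih =>
        rw [sigPhi, ih, cnt_Z hν hi hi']
        omega
    rw [h1, cnt_eq_zero_of_colLen_le _ le_rfl]

theorem A_mem_E (hν : ν.colLen 0 ≤ n) (T : Tab n ν) : A n ν hν ∈ E T := by
  induction hm : T.reading.sum using Nat.strong_induction_on generalizing T with
  | _ m ih =>
    by_cases h : ∀ i, e i T = none
    · rw [(forall_e_eq_none_iff hν).1 h]
      exact mem_E_iff.2 .refl
    · push Not at h
      obtain ⟨i, hi⟩ := h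
      obtain ⟨T', hT'⟩ := Option.ne_none_iff_exists'.1 hi
      have := wordE_sum (e_eq_some_iff_reading.1 hT')
      exact mem_E_iff.2 ((mem_E_iff.1 (ih _ (by omega) T' rfl)).head ⟨i, hT'⟩)

/-- Each f_i adds one to the sum of the entries, which is at most n times their number. The process
stops only where all f_i vanish. -/
theorem Z_mem_F (hν : ν.colLen 0 ≤ n) (T : Tab n ν) : Z n ν hν ∈ F T := by
  induction hm : T.reading.length * n - T.reading.sum using Nat.strong_induction_on
    generalizing T with
  | _ m ih =>
    by_cases h : ∀ i, f i T = none
    · rw [(forall_f_eq_none_iff hν).1 h]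
      exact mem_F_iff.2 .refl
    · push Not at h
      obtain ⟨i, hi⟩ := h
      obtain ⟨T', hT'⟩ := Option.ne_none_iff_exists'.1 hi
      obtain ⟨h1, h2⟩ := wordF_sum (f_eq_some_iff_reading.1 hT')
      have h3 : T'.reading.sum ≤ T'.reading.length * n := by
        rw [← smul_eq_mul]
        refine List.sum_le_card_nsmul _ _ fun x hx => ?_
        simp only [reading, List.mem_flatMap] at hx
        obtain ⟨s, -, hs⟩ := hx
        obtain ⟨j, hj, rfl⟩ := mem_row.1 hs
        exact (T'.2 s j hj).2
      rw [h2] at h3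
      exact mem_F_iff.2 ((mem_F_iff.1 (ih _ (by rw [h2]; omega) T' rfl)).head ⟨i, hT'⟩)

end Tab

/-! ### Star products with extremal tableaux -/

namespace Tab

variable {n : ℕ} {κ ν : YoungDiagram}

/-- A crude bound suffices, since surplus rows are empty. -/
theorem colLen_shapeAdd_le : (shapeAdd κ ν).colLen 0 ≤ κ.colLen 0 + ν.colLen 0 := by
  by_contra! h
  have h1 : (κ.colLen 0 + ν.colLen 0, 0) ∈ shapeAdd κ ν := YoungDiagram.mem_iff_lt_colLen.2 h
  have h2 : (κ.colLen 0 + ν.colLen 0, 0) ∈ (shapeAdd κ ν).cells := h1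
  simp [shapeAdd] at h2

theorem cnt_star (T : Tab n κ) (T' : Tab n ν) (x s : ℕ) :
    (star T T').cnt x s = T.cnt x s + T'.cnt x s :=
  ((row_star T T' s).count_eq x).trans List.count_append

theorem f_starMap {S : Tab n ν} {i : CrystalIndex n} {x y : Tab n κ} {k : ℕ}
    (hk : κ.colLen 0 + ν.colLen 0 ≤ k)
    (h : sigF ((star x S).cnt i) ((star x S).cnt (i + 1)) k =
      sigF (x.cnt i) (x.cnt (i + 1)) k)
    (hf : f i x = some y) : f i (starMap κ S x) = some (starMap κ S y) := by
  obtain ⟨r, h1, h2⟩ := (f_eq_some_iff (k := k) (by omega)).1 hf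
  exact (f_eq_some_iff (colLen_shapeAdd_le.trans hk)).2 ⟨r, h.trans h1, h2.star S⟩

theorem e_starMap {S : Tab n ν} {i : CrystalIndex n} {x y : Tab n κ} {k : ℕ}
    (hk : κ.colLen 0 + ν.colLen 0 ≤ k)
    (h : sigE ((star x S).cnt i) ((star x S).cnt (i + 1)) k =
      sigE (x.cnt i) (x.cnt (i + 1)) k)
    (he : e i x = some y) : e i (starMap κ S x) = some (starMap κ S y) := by
  obtain ⟨r, h1, h2⟩ := (e_eq_some_iff (k := k) (by omega)).1 he
  exact (e_eq_some_iff (colLen_shapeAdd_le.trans hk)).2 ⟨r, h.trans h1, h2.star S⟩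

theorem sigE_star_A (hν : ν.colLen 0 ≤ n) (i : CrystalIndex n) (x : Tab n κ) (k : ℕ) :
    sigE ((star x (A n ν hν)).cnt i) ((star x (A n ν hν)).cnt (i + 1)) k =
      sigE (x.cnt i) (x.cnt (i + 1)) k := by
  obtain ⟨i, hi, hi'⟩ := i
  obtain ⟨t, rfl⟩ : ∃ t, i = t + 1 := ⟨i - 1, by omega⟩
  refine sigE_add_top (i := t) (p := ν.rowLen t) (q := ν.rowLen (t + 1))
    (ν.rowLen_anti t (t + 1) (by omega)) (fun s hs => x.cnt_eq_zero_of_le hs)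
    (x.cnt_succ_diag_le t) (fun s hs => ?_) (fun s hs => ?_) ?_ ?_ k
  · rw [cnt_star, cnt_A, if_neg (by simp only; omega), add_zero]
  · rw [cnt_star, cnt_A, if_neg (by simp only; omega), add_zero]
  · rw [cnt_star, cnt_A, if_pos rfl]
  · rw [cnt_star, cnt_A, if_pos rfl]

theorem sigF_star_Z (hν : ν.colLen 0 ≤ n) (i : CrystalIndex n) (x : Tab n κ) {k : ℕ}
    (hk : ν.colLen 0 ≤ k) :
    sigF ((star x (Z n ν hν)).cnt i) ((star x (Z n ν hν)).cnt (i + 1)) (k + 1) =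
      sigF (x.cnt i) (x.cnt (i + 1)) (k + 1) := by
  refine sigF_add_pairs (z := (Z n ν hν).cnt i) (fun s => cnt_star _ _ _ _) (fun s => ?_)
    (cnt_eq_zero_of_colLen_le _ hk)
  rw [cnt_star, cnt_Z hν i.2.1 i.2.2]

theorem isCrystalEmbedding_of {Φ : Tab n κ → Tab n ν} (hinj : Function.Injective Φ)
    (he : ∀ i x y, e i x = some y → e i (Φ x) = some (Φ y))
    (hf : ∀ i x y, f i x = some y → f i (Φ x) = some (Φ y)) : IsCrystalEmbedding Φ := by
  refine ⟨hinj, fun i x h => ?_, fun i x h => ?_⟩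
  · obtain ⟨y, hy⟩ := Option.ne_none_iff_exists'.1 h
    simp [hy, he i x y hy]
  · obtain ⟨y, hy⟩ := Option.ne_none_iff_exists'.1 h
    simp [hy, hf i x y hy]

/-! ### Star product with the highest weight vector -/

section A

variable (hν : ν.colLen 0 ≤ n) {i : CrystalIndex n} {x y : Tab n κ}

theorem e_starMap_A :
    e i (starMap κ (A n ν hν) x) = (e i x).map (starMap κ (A n ν hν)) := by
  have hs := sigE_star_A hν i x (κ.colLen 0 + ν.colLen 0)
  cases h : e i x with
  | none =>
    rw [e_eq_none_iff (k := κ.colLen 0 + ν.colLen 0) (by omega), ← hs] at h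
    exact (e_eq_none_iff colLen_shapeAdd_le).2 h
  | some y => exact e_starMap le_rfl hs h

/-- One inclusion transports a path of operators e_i from Z_κ to any given tableau; the other holds
because the image is closed under e_i. -/
theorem range_starMap_A (hκ : κ.colLen 0 ≤ n) :
    Set.range (starMap κ (A n ν hν)) = E (star (Z n κ hκ) (A n ν hν)) := by
  ext T
  rw [mem_E_iff]
  constructor
  · rintro ⟨x, rfl⟩
    refine (mem_E_iff.1 (mem_E_iff_mem_F.2 (Z_mem_F hκ x))).lift (starMap κ (A n ν hν)) ?_
    rintro y z ⟨i, hi⟩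
    exact ⟨i, by rw [e_starMap_A, hi]; rfl⟩
  · intro h
    induction h with
    | refl => exact ⟨_, rfl⟩
    | tail _ h ih =>
      obtain ⟨x, rfl⟩ := ih
      obtain ⟨i, hi⟩ := h
      rw [e_starMap_A] at hi
      obtain ⟨y, -, rfl⟩ := Option.map_eq_some_iff.1 hi
      exact ⟨y, rfl⟩

theorem e_starMap_A_iff :
    e i x = some y ↔ e i (starMap κ (A n ν hν) x) = some (starMap κ (A n ν hν) y) := by
  rw [e_starMap_A, Option.map_eq_some_iff]
  refine ⟨fun h => ⟨y, h, rfl⟩, fun ⟨z, h, hz⟩ => ?_⟩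
  rw [h, star_left_injective _ hz]

/-- Deduced by inversion, as Φ_A need not commute with f_i where f_i gives 0: added letters i may be
unbracketed. -/
theorem f_starMap_A_iff :
    f i x = some y ↔ f i (starMap κ (A n ν hν) x) = some (starMap κ (A n ν hν) y) := by
  rw [f_eq_some_iff_e, f_eq_some_iff_e, e_starMap_A_iff hν]

end A

/-! ### Star product with the lowest weight vector -/

section Z

variable (hν : ν.colLen 0 ≤ n) {i : CrystalIndex n} {x y : Tab n κ}

theorem f_starMap_Z :
    f i (starMap κ (Z n ν hν) x) = (f i x).map (starMap κ (Z n ν hν)) := by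
  have hs := sigF_star_Z hν i x (k := κ.colLen 0 + ν.colLen 0) (by omega)
  cases h : f i x with
  | none =>
    rw [f_eq_none_iff (k := κ.colLen 0 + ν.colLen 0 + 1) (by omega), ← hs] at h
    exact (f_eq_none_iff (colLen_shapeAdd_le.trans (Nat.le_succ _))).2 h
  | some y => exact f_starMap (Nat.le_succ _) hs h

theorem range_starMap_Z (hκ : κ.colLen 0 ≤ n) :
    Set.range (starMap κ (Z n ν hν)) = F (star (A n κ hκ) (Z n ν hν)) := by
  ext T
  rw [mem_F_iff]
  constructor
  · rintro ⟨x, rfl⟩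
    refine (mem_F_iff.1 (mem_E_iff_mem_F.1 (A_mem_E hκ x))).lift (starMap κ (Z n ν hν)) ?_
    rintro y z ⟨i, hi⟩
    exact ⟨i, by rw [f_starMap_Z, hi]; rfl⟩
  · intro h
    induction h with
    | refl => exact ⟨_, rfl⟩
    | tail _ h ih =>
      obtain ⟨x, rfl⟩ := ih
      obtain ⟨i, hi⟩ := h
      rw [f_starMap_Z] at hi
      obtain ⟨y, -, rfl⟩ := Option.map_eq_some_iff.1 hi
      exact ⟨y, rfl⟩

theorem f_starMap_Z_iff :
    f i x = some y ↔ f i (starMap κ (Z n ν hν) x) = some (starMap κ (Z n ν hν) y) := by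
  rw [f_starMap_Z, Option.map_eq_some_iff]
  refine ⟨fun h => ⟨y, h, rfl⟩, fun ⟨z, h, hz⟩ => ?_⟩
  rw [h, star_left_injective _ hz]

theorem e_starMap_Z_iff :
    e i x = some y ↔ e i (starMap κ (Z n ν hν) x) = some (starMap κ (Z n ν hν) y) := by
  rw [← f_eq_some_iff_e, ← f_eq_some_iff_e, f_starMap_Z_iff hν]

end Z

theorem exists_isInducedIso_of_range_eq {Φ : Tab n κ → Tab n ν} {S : Set (Tab n ν)}
    (hinj : Function.Injective Φ) (hS : Set.range Φ = S)
    (hf : ∀ i x y, f i x = some y ↔ f i (Φ x) = some (Φ y))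
    (he : ∀ i x y, e i x = some y ↔ e i (Φ x) = some (Φ y)) :
    ∃ ψ : (Set.univ : Set (Tab n κ)) ≃ S, IsInducedIso ψ ∧ ∀ x, (ψ x).1 = Φ x.1 := by
  subst hS
  exact ⟨(Equiv.Set.univ _).trans (Equiv.ofInjective Φ hinj),
    fun i x y => ⟨hf i x.1 y.1, he i x.1 y.1⟩, fun _ => rfl⟩

end Tab

theorem mainTheorem5 (n : ℕ) (lam mu : YoungDiagram)
    (hlam : lam.colLen 0 ≤ n) (hmu : mu.colLen 0 ≤ n) :
    -- `A_ν` and `Z_ν` are the unique highest and lowest weight vectors of `B(ν)`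
    (∀ (nu : YoungDiagram) (hnu : nu.colLen 0 ≤ n) (T : Tab n nu),
      (T.IsHighestWeight ↔ T = Tab.A n nu hnu) ∧ (T.IsLowestWeight ↔ T = Tab.Z n nu hnu)) ∧
    -- `Φ_T` is a crystal embedding for `T` of highest or lowest weight
    (∀ T : Tab n mu, T.IsHighestWeight ∨ T.IsLowestWeight →
      Tab.IsCrystalEmbedding (Tab.starMap lam T)) ∧
    -- the images
    Set.range (Tab.starMap lam (Tab.A n mu hmu)) =
      Tab.E (Tab.star (Tab.Z n lam hlam) (Tab.A n mu hmu)) ∧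
    Set.range (Tab.starMap lam (Tab.Z n mu hmu)) =
      Tab.F (Tab.star (Tab.A n lam hlam) (Tab.Z n mu hmu)) ∧
    -- `Φ_T` is an isomorphism from `B(λ)` onto the subgraph induced on its image
    (∃ ψ : (Set.univ : Set (Tab n lam)) ≃
        Tab.E (Tab.star (Tab.Z n lam hlam) (Tab.A n mu hmu)),
      Tab.IsInducedIso ψ ∧ ∀ x, (ψ x).1 = Tab.starMap lam (Tab.A n mu hmu) x.1) ∧
    (∃ ψ : (Set.univ : Set (Tab n lam)) ≃
        Tab.F (Tab.star (Tab.A n lam hlam) (Tab.Z n mu hmu)),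
      Tab.IsInducedIso ψ ∧ ∀ x, (ψ x).1 = Tab.starMap lam (Tab.Z n mu hmu) x.1) ∧
    -- the two embedded copies of `B(λ)` are isomorphic
    (∃ ψ : Tab.E (Tab.star (Tab.Z n lam hlam) (Tab.A n mu hmu)) ≃
        Tab.F (Tab.star (Tab.A n lam hlam) (Tab.Z n mu hmu)),
      Tab.IsInducedIso ψ) := by
  have hA := Tab.exists_isInducedIso_of_range_eq (Tab.star_left_injective (Tab.A n mu hmu))
    (Tab.range_starMap_A hmu hlam) (fun _ _ _ => Tab.f_starMap_A_iff hmu)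
    (fun _ _ _ => Tab.e_starMap_A_iff hmu)
  have hZ := Tab.exists_isInducedIso_of_range_eq (Tab.star_left_injective (Tab.Z n mu hmu))
    (Tab.range_starMap_Z hmu hlam) (fun _ _ _ => Tab.f_starMap_Z_iff hmu)
    (fun _ _ _ => Tab.e_starMap_Z_iff hmu)
  refine ⟨fun nu hnu T => ⟨?_, ?_⟩, ?_, Tab.range_starMap_A hmu hlam,
    Tab.range_starMap_Z hmu hlam, hA, hZ, ?_⟩
  · rw [Tab.isHighestWeight_iff, Tab.forall_e_eq_none_iff hnu]
  · rw [Tab.isLowestWeight_iff, Tab.forall_f_eq_none_iff hnu]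
  · rintro T (hT | hT)
    · rw [Tab.isHighestWeight_iff, Tab.forall_e_eq_none_iff hmu] at hT
      subst hT
      exact Tab.isCrystalEmbedding_of (Tab.star_left_injective _)
        (fun _ _ _ => (Tab.e_starMap_A_iff hmu).1) (fun _ _ _ => (Tab.f_starMap_A_iff hmu).1)
    · rw [Tab.isLowestWeight_iff, Tab.forall_f_eq_none_iff hmu] at hT
      subst hT
      exact Tab.isCrystalEmbedding_of (Tab.star_left_injective _)
        (fun _ _ _ => (Tab.e_starMap_Z_iff hmu).1) (fun _ _ _ => (Tab.f_starMap_Z_iff hmu).1)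
  · obtain ⟨ψ, hψ, -⟩ := hA
    obtain ⟨χ, hχ, -⟩ := hZ
    refine ⟨ψ.symm.trans χ, fun i x y => ?_⟩
    have h1 := hψ i (ψ.symm x) (ψ.symm y)
    have h2 := hχ i (ψ.symm x) (ψ.symm y)
    rw [ψ.apply_symm_apply, ψ.apply_symm_apply] at h1
    exact ⟨h1.1.symm.trans h2.1, h1.2.symm.trans h2.2⟩
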